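/- Let $d\in\mathbb N$, $S=\mathbb R^d\times\mathbb R\times(0,\infty)$, let $f$ be a probability density on $(0,\infty)$ and put $\tilde c(\mathrm d\xi,\mathrm ds,\mathrm d\lambda)=\mathrm d\xi\,\mathrm ds\,f(\lambda)\,\mathrm d\lambda$. Let $\mathcal B$ be a class of Borel subsets of $S$ of finite $\tilde c$-measure that contains all bounded Borel sets and is closed under finite unions and under passing to Borel subsets (for instance the bounded Borel sets or, if $f$ is bounded, the Borel sets of finite Lebesgue measure). Let $L=\{L(E):E\in\mathcal B\}$ be a Lévy basis: a family of real random variables with $L(\bigcup_jE_j)=\sum_jL(E_j)$ almost surely for disjoint $E_j\in\mathcal B$ with $\bigcup_j E_j\in\mathcal B$, with $L(E_i)$ and $L(E_j)$ independent for $i\ne j$, and such that every vector $(L(B_1),\dots,L(B_m))$ with $B_i\in\mathcal B$ is infinitely divisible. Let $L$ have characteristic quadruplet $(a,b,\nu,\tilde c)$, where $a\in\mathbb R$, $b\ge0$ and $\nu$ is a Lévy measure on $\mathbb R$; that is, for $E\in\mathcal B$ and $\theta\in\mathbb R$, $$\mathbb E\,e^{i\theta L(E)}=e^{\tilde c(E)\psi(\theta)},\qquad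 \psi(\theta)=i\theta a-\tfrac12\theta^2b+\int_{\mathbb R}\bigl(e^{i\theta z}-1-i\theta z\mathbf 1_{|z|\le1}\bigr)\nu(\mathrm dz).$$ Assume $\mathbb E[L(E)^2]<\infty$ for all $E\in\mathcal B$. Let $L'$ be the Lévy seed, a random variable with $\mathbb E\,e^{i\theta L'}=e^{\psi(\theta)}$. Let $A_t(x)\subset\mathbb R^d\times\mathbb R$ ($t\in\mathbb R$, $x\in\mathbb R^d$) be Borel sets with $A_t(x)=A_0(0)+(x,t)$, $A_s(x)\subset A_t(x)$ for $s<t$, and $A_t(x)\cap(\mathbb R^d\times(t,\infty))=\emptyset$. Assume that for all $t,x$ $$\int_0^\infty\!\int_{A_t(x)}e^{-\lambda(t-s)}f(\lambda)\,\mathrm d\xi\,\mathrm ds\,\mathrm d\lambda<\infty,\qquad \int_0^\infty\!\int_{A_t(x)}e^{-2\lambda(t-s)}f(\lambda)\,\mathrm d\xi\,\mathrm ds\,\mathrm d\lambda<\infty .$$ Let $Y$ be the mixed spatio-temporal Ornstein–Uhlenbeck (MSTOU) process $$Y_t(x)=\int_0^\infty\!\int_{A_t(x)}e^{-\lambda(t-s)}L(\mathrm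 d\xi,\mathrm ds,\mathrm d\lambda)=\int_S g\,\mathrm dL,\qquad g(\xi,s,\lambda)=\mathbf 1_{A_t(x)}(\xi,s)e^{-\lambda(t-s)},$$ meaning that there are simple functions $g_n=\sum_jy_j\mathbf 1_{E_j}$ (finite sums, disjoint $E_j\in\mathcal B$) with $g_n\to g$ $\tilde c$-almost everywhere, such that $\int_Bg_n\,\mathrm dL:=\sum_jy_jL(B\cap E_j)$ converges in probability for every Borel set $B\subset S$, and $Y_t(x)$ is the limit in probability for $B=S$. Then $\int_{|z|>1}|z|\,\nu(\mathrm dz)<\infty$, $\int_{\mathbb R}z^2\,\nu(\mathrm dz)<\infty$, $L'$ and all $Y_t(x)$ have finite second moments, and for all $t,d_t\in\mathbb R$ and $x,d_x\in\mathbb R^d$, $$\mathbb E[Y_t(x)]=\Bigl[a+\int_{|z|>1}z\,\nu(\mathrm dz)\Bigr]\int_0^\infty\!\int_{A_t(x)}e^{-\lambda(t-s)}\,\mathrm d\xi\,\mathrm ds\,f(\lambda)\,\mathrm d\lambda=\mathbb E[L']\int_0^\infty\!\int_{A_t(x)}e^{-\lambda(t-s)}\,\mathrm d\xi\,\mathrm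 ds\,f(\lambda)\,\mathrm d\lambda,$$ $$\operatorname{Cov}\bigl(Y_t(x),Y_{t+d_t}(x+d_x)\bigr)=\Bigl[b+\int_{\mathbb R}z^2\,\nu(\mathrm dz)\Bigr]I=\operatorname{Var}(L')\,I,\qquad I=\int_0^\infty\!\int_{A_t(x)\cap A_{t+d_t}(x+d_x)}e^{-2\lambda(t-s)-\lambda d_t}\,\mathrm d\xi\,\mathrm ds\,f(\lambda)\,\mathrm d\lambda .$$ -/

import Mathlib

open MeasureTheory ProbabilityTheory Filter Topology
open scoped ENNReal

noncomputable section

namespace MSTOU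

/-- Space `ℝ^d`. -/
abbrev Space (d : ℕ) : Type := EuclideanSpace ℝ (Fin d)

/-- The product `S = ℝ^d × ℝ × (0, ∞)` of space, time and the rate parameter space. -/
abbrev Pt (d : ℕ) : Type := Space d × ℝ × Set.Ioi (0 : ℝ)

/-- `f` is (the restriction to `(0, ∞)` of) a probability density on `(0, ∞)`. -/
structure IsProbDensity (f : ℝ → ℝ) : Prop where
  measurable : Measurable f
  nonneg : ∀ l, 0 < l → 0 ≤ f l
  lintegral_eq_one : ∫⁻ l in Set.Ioi (0 : ℝ), ENNReal.ofReal (f l) = 1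

/-- The measure `dξ ds f(λ) dλ` on `S`. -/
def controlMeasure (d : ℕ) (f : ℝ → ℝ) : Measure (Pt d) :=
  (volume : Measure (Space d)).prod
    ((volume : Measure ℝ).prod
      ((Measure.comap Subtype.val (volume : Measure ℝ) : Measure (Set.Ioi (0 : ℝ))).withDensity
        (fun l => ENNReal.ofReal (f l))))

/-- A class `𝓑` of Borel sets of `S` on which a random measure with control measure `c` may be
defined: it contains the bounded Borel sets, is stable under finite unions and under passing to
Borel subsets, and its members have finite `c`-measure.  Typical cases are the bounded Borel sets
and, if the density `f` is bounded, the Borel sets of finite Lebesgue measure. -/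
structure IsBoundedClass {d : ℕ} (c : Measure (Pt d)) (𝓑 : Set (Set (Pt d))) : Prop where
  measurableSet : ∀ E ∈ 𝓑, MeasurableSet E
  bounded_mem : ∀ E, MeasurableSet E → Bornology.IsBounded E → E ∈ 𝓑
  union_mem : ∀ E ∈ 𝓑, ∀ F ∈ 𝓑, E ∪ F ∈ 𝓑
  subset_mem : ∀ E ∈ 𝓑, ∀ F, MeasurableSet F → F ⊆ E → F ∈ 𝓑
  measure_lt_top : ∀ E ∈ 𝓑, c E < ∞

/-- The `n`-fold convolution `μ * ⋯ * μ`. -/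
def convPow {V : Type*} [AddMonoid V] [MeasurableSpace V] (μ : Measure V) : ℕ → Measure V
  | 0 => Measure.dirac 0
  | n + 1 => (convPow μ n).conv μ

/-- Infinite divisibility of a probability law. -/
def IsInfDivisible {V : Type*} [AddMonoid V] [MeasurableSpace V] (μ : Measure V) : Prop :=
  ∀ n : ℕ, 0 < n → ∃ ρ : Measure V, IsProbabilityMeasure ρ ∧ μ = convPow ρ n

/-- A Lévy basis: an independently scattered, infinitely divisible random measure
`{L(E) : E ∈ 𝓑}`. Values of `L` outside `𝓑` are irrelevant. -/
structure IsLevyBasis {d : ℕ} {Ω : Type*} [MeasurableSpace Ω] (P : Measure Ω)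
    (𝓑 : Set (Set (Pt d))) (L : Set (Pt d) → Ω → ℝ) : Prop where
  measurable : ∀ E ∈ 𝓑, Measurable (L E)
  sigma_additive : ∀ E : ℕ → Set (Pt d), (∀ i, E i ∈ 𝓑) → Pairwise (Function.onFun Disjoint E) →
    (⋃ i, E i) ∈ 𝓑 →
    ∀ᵐ ω ∂P, Tendsto (fun n => ∑ i ∈ Finset.range n, L (E i) ω) atTop (𝓝 (L (⋃ i, E i) ω))
  indep : ∀ E : ℕ → Set (Pt d), (∀ i, E i ∈ 𝓑) → Pairwise (Function.onFun Disjoint E) →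
    ∀ i j, i ≠ j → IndepFun (L (E i)) (L (E j)) P
  infDivisible : ∀ (m : ℕ) (B : Fin m → Set (Pt d)), (∀ i, B i ∈ 𝓑) →
    IsInfDivisible (P.map (fun ω i => L (B i) ω))

/-- Lévy measures on `ℝ`. -/
structure IsLevyMeasure (ν : Measure ℝ) : Prop where
  zero : ν {0} = 0
  lintegral_lt_top : ∫⁻ z, ENNReal.ofReal (min 1 (z ^ 2)) ∂ν < ∞

/-- The Lévy–Khintchine exponent
`iθa - θ²b/2 + ∫ (e^{iθz} - 1 - iθz 1_{|z| ≤ 1}) ν(dz)`. -/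
def levyExponent (a b : ℝ) (ν : Measure ℝ) (θ : ℝ) : ℂ :=
  Complex.I * θ * a - (θ : ℂ) ^ 2 * b / 2 +
    ∫ z : ℝ, (Complex.exp (Complex.I * θ * z) - 1 -
      if |z| ≤ 1 then Complex.I * θ * z else 0) ∂ν

/-- `L` has the (constant) characteristic quadruplet `(a, b, ν, c)`: for `E ∈ 𝓑` the cumulant
function of `L(E)` is the Lévy–Khintchine exponent of the triplet `(a c(E), b c(E), c(E) ν)`, that
is, `c(E)` times the exponent of `(a, b, ν)`.  Since that exponent is continuous in `θ` and
vanishes at `0`, the exponential form below is the same as equality of distinguished logarithms. -/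
structure HasCharQuadruplet {d : ℕ} {Ω : Type*} [MeasurableSpace Ω] (P : Measure Ω)
    (𝓑 : Set (Set (Pt d))) (L : Set (Pt d) → Ω → ℝ)
    (a b : ℝ) (ν : Measure ℝ) (c : Measure (Pt d)) : Prop where
  b_nonneg : 0 ≤ b
  levyMeasure : IsLevyMeasure ν
  charFun_eq : ∀ E ∈ 𝓑, ∀ θ : ℝ,
    charFun (P.map (L E)) θ = Complex.exp ((c E).toReal * levyExponent a b ν θ)

/-- `L'` is a Lévy seed: a random variable with characteristic triplet `(a, b, ν)`. -/
structure IsLevySeed {Ω' : Type*} [MeasurableSpace Ω'] (P' : Measure Ω') (L' : Ω' → ℝ)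
    (a b : ℝ) (ν : Measure ℝ) : Prop where
  measurable : Measurable L'
  charFun_eq : ∀ θ : ℝ, charFun (P'.map L') θ = Complex.exp (levyExponent a b ν θ)

/-- A simple function `∑ j, y j • 1_{E j}` with disjoint `E j ∈ 𝓑`. -/
structure SimpleFn {d : ℕ} (𝓑 : Set (Set (Pt d))) where
  m : ℕ
  E : Fin m → Set (Pt d)
  y : Fin m → ℝ
  mem : ∀ j, E j ∈ 𝓑
  disj : Pairwise (Function.onFun Disjoint E)

/-- The function on `S` given by a simple function. -/
def SimpleFn.toFun {d : ℕ} {𝓑 : Set (Set (Pt d))} (g : SimpleFn 𝓑) (z : Pt d) : ℝ :=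
  ∑ j, g.y j * (g.E j).indicator (fun _ => (1 : ℝ)) z

/-- The stochastic integral `∫_A g dL = ∑ j, y j * L (A ∩ E j)` of a simple function. -/
def SimpleFn.integral {d : ℕ} {𝓑 : Set (Set (Pt d))} {Ω : Type*} (g : SimpleFn 𝓑)
    (L : Set (Pt d) → Ω → ℝ) (A : Set (Pt d)) (ω : Ω) : ℝ :=
  ∑ j, g.y j * L (A ∩ g.E j) ω

/-- The measurable function `g` is `L`-integrable and `∫_A g dL = X`: there are simple functions
`gₙ → g` `c`-almost everywhere such that `∫_B gₙ dL` converges in probability for every Borel `B`,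
and `X` is the limit in probability of `∫_A gₙ dL`. -/
def IsStochIntegral {d : ℕ} {Ω : Type*} [MeasurableSpace Ω] (P : Measure Ω)
    (𝓑 : Set (Set (Pt d))) (L : Set (Pt d) → Ω → ℝ) (c : Measure (Pt d))
    (g : Pt d → ℝ) (A : Set (Pt d)) (X : Ω → ℝ) : Prop :=
  Measurable g ∧ ∃ gs : ℕ → SimpleFn 𝓑,
    (∀ᵐ z ∂c, Tendsto (fun n => (gs n).toFun z) atTop (𝓝 (g z))) ∧
    (∀ B : Set (Pt d), MeasurableSet B →
      ∃ Z : Ω → ℝ, TendstoInMeasure P (fun n => (gs n).integral L B) atTop Z) ∧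
    TendstoInMeasure P (fun n => (gs n).integral L A) atTop X

/-- A family of ambit sets `A_t(x) ⊆ ℝ^d × ℝ`. -/
structure IsAmbit {d : ℕ} (A : ℝ → Space d → Set (Space d × ℝ)) : Prop where
  measurableSet : ∀ t x, MeasurableSet (A t x)
  translation : ∀ t x, A t x = (fun p => p + (x, t)) '' A 0 0
  mono : ∀ x s t, s < t → A s x ⊆ A t x
  nonanticipative : ∀ t x, A t x ∩ (Set.univ ×ˢ Set.Ioi t) = ∅

/-- The integrand `1_{A_t(x)}(ξ, s) exp(-λ(t - s))` of the process at `(x, t)`. -/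
def kernel {d : ℕ} (A : ℝ → Space d → Set (Space d × ℝ)) (t : ℝ) (x : Space d) (z : Pt d) : ℝ :=
  (A t x).indicator (fun p => Real.exp (-(z.2.2 : ℝ) * (t - p.2))) (z.1, z.2.1)

/-- `Y` is the mixed spatio-temporal Ornstein–Uhlenbeck process
`Y_t(x) = ∫_0^∞ ∫_{A_t(x)} exp(-λ(t - s)) L(dξ, ds, dλ)`. -/
def IsMSTOU {d : ℕ} {Ω : Type*} [MeasurableSpace Ω] (P : Measure Ω)
    (𝓑 : Set (Set (Pt d))) (L : Set (Pt d) → Ω → ℝ) (c : Measure (Pt d))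
    (A : ℝ → Space d → Set (Space d × ℝ)) (Y : ℝ → Space d → Ω → ℝ) : Prop :=
  ∀ t x, IsStochIntegral P 𝓑 L c (kernel A t x) Set.univ (Y t x)

end MSTOU

end

/-! ### Quadratic bounds on characteristic functions and finite second moments -/

namespace MSTOU

/-! The formulas hold for integrals of simple functions by bilinearity; the work lies in the moments
of `L` and in the passage to the limit.

Moments. Choose E in the class with c(E) > 0. Square integrability of L(E) bounds the real part of
its characteristic function below by 1 - O(θ²), while its modulus is at most exp(-c(E) ∫ (1 - cos
θz) ν(dz)). So the last integral is O(θ²), and Fatou yields ∫ z² dν < ∞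
(`integrable_sq_levyMeasure`). Now the exponent can be differentiated twice at 0, and L(E) has mean
m c(E) and variance v c(E), where m = a + ∫_{|z|>1} z dν and v = b + ∫ z² dν
(`moments_of_charFun_eq`). The seed is the case c = 1, its second moment coming from the same Fatou
argument. Additivity and independence on disjoint sets give Cov(L(E), L(F)) = v c(E ∩ F). Hence an
elementary integral of h has mean m ∫ h dc, two of them have covariance v ∫ h h' dc, and the L² norm
is at most (|m| + √|v|)(‖h‖₁ + ‖h‖₂) (`HasOrthogonalIncrements.eLpNorm_snd_le`).

Limit. The simple functions defining Y converge to the kernel only almost everywhere, not in any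
norm. Egorov makes the convergence uniform on an exhausting sequence of sets of finite measure. A
gliding hump (`exists_gliding_hump`) then finds a set D such that one subsequence converges in L¹
and L² on D and another one on its complement. The integrals over D and over its complement converge
in probability, so the two subsequences may be glued without changing the limit Y. The glued
integrals are Cauchy in L², hence converge to Y in L², and mean and covariance pass to the limit.
Fubini rewrites the resulting integrals of the kernel and of products of kernels. -/

lemma tendsto_two_mul_one_sub_cos_div_sq (z : ℝ) :
    Tendsto (fun n : ℕ => 2 * (1 - Real.cos ((1 / ((n : ℝ) + 1)) * z)) / (1 / ((n : ℝ) + 1)) ^ 2)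
      atTop (𝓝 (z ^ 2)) := by
  -- Since 1 - cos(θz) = 2 sin²(θz/2), the quotient is the square of the difference quotient at 0 of
  -- 2 sin(θz/2), whose derivative there is z.
  have hd : HasDerivAt (fun t : ℝ => 2 * Real.sin (t * (z / 2))) z 0 := by
    have h := (((hasDerivAt_id (0 : ℝ)).mul_const (z / 2)).sin).const_mul 2
    refine h.congr_deriv ?_
    simp
    ring
  have h1 := hd.tendsto_slope_zero
  have h2 : Tendsto (fun n : ℕ => 1 / ((n : ℝ) + 1)) atTop (𝓝[≠] 0) :=
    tendsto_nhdsWithin_iff.2 ⟨tendsto_one_div_add_atTop_nhds_zero_nat,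
      Eventually.of_forall fun n => (Nat.one_div_pos_of_nat (n := n)).ne'⟩
  refine ((h1.comp h2).pow 2).congr fun n => ?_
  have hc : Real.cos ((1 / ((n : ℝ) + 1)) * z)
      = 1 - 2 * Real.sin ((1 / ((n : ℝ) + 1)) * (z / 2)) ^ 2 := by
    rw [show (1 / ((n : ℝ) + 1)) * z = 2 * ((1 / ((n : ℝ) + 1)) * (z / 2)) by ring,
      Real.cos_two_mul, Real.cos_sq']
    ring
  rw [hc]
  simp only [Function.comp, zero_add, zero_mul, Real.sin_zero, mul_zero, sub_zero, smul_eq_mul]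
  ring

/-- By Fatou's lemma, a quadratic bound of `θ ↦ ∫ (1 - cos (θ z)) μ(dz)` near `0` yields a finite
second moment. -/
lemma integrable_sq_of_lintegral_one_sub_cos_le (μ : Measure ℝ) {C : ℝ}
    (h : ∀ᶠ θ in 𝓝 (0 : ℝ), ∫⁻ z, ENNReal.ofReal (1 - Real.cos (θ * z)) ∂μ
      ≤ ENNReal.ofReal (C * θ ^ 2)) :
    Integrable (fun z : ℝ => z ^ 2) μ := by
  refine ⟨by fun_prop, ?_⟩
  rw [hasFiniteIntegral_iff_ofReal (Eventually.of_forall fun z => sq_nonneg z)]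
  set F : ℕ → ℝ → ℝ≥0∞ := fun n z => ENNReal.ofReal
    (2 * (1 - Real.cos ((1 / ((n : ℝ) + 1)) * z)) / (1 / ((n : ℝ) + 1)) ^ 2) with hF
  have hlim (z : ℝ) : ENNReal.ofReal (z ^ 2) = liminf (fun n => F n z) atTop :=
    ((ENNReal.continuous_ofReal.tendsto _).comp
      (tendsto_two_mul_one_sub_cos_div_sq z)).liminf_eq.symm
  have hbound : ∀ᶠ n : ℕ in atTop, ∫⁻ z, F n z ∂μ ≤ ENNReal.ofReal (2 * C) := by
    filter_upwards [tendsto_one_div_add_atTop_nhds_zero_nat.eventually h] with n hn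
    have hp : (0 : ℝ) < 1 / ((n : ℝ) + 1) := by positivity
    simp only [hF]
    generalize 1 / ((n : ℝ) + 1) = θ at hn hp
    have hFe (z : ℝ) : ENNReal.ofReal (2 * (1 - Real.cos (θ * z)) / θ ^ 2)
        = ENNReal.ofReal (2 / θ ^ 2) * ENNReal.ofReal (1 - Real.cos (θ * z)) := by
      rw [← ENNReal.ofReal_mul (by positivity)]
      congr 1
      ring
    calc ∫⁻ z, ENNReal.ofReal (2 * (1 - Real.cos (θ * z)) / θ ^ 2) ∂μ
        = ENNReal.ofReal (2 / θ ^ 2) * ∫⁻ z, ENNReal.ofReal (1 - Real.cos (θ * z)) ∂μ := by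
          simp_rw [hFe]
          exact lintegral_const_mul _ (by fun_prop)
      _ ≤ ENNReal.ofReal (2 / θ ^ 2) * ENNReal.ofReal (C * θ ^ 2) := by gcongr
      _ = ENNReal.ofReal (2 * C) := by
          rw [← ENNReal.ofReal_mul (by positivity)]
          congr 1
          field_simp
  calc ∫⁻ z, ENNReal.ofReal (z ^ 2) ∂μ = ∫⁻ z, liminf (fun n => F n z) atTop ∂μ := by
        simp_rw [hlim]
    _ ≤ liminf (fun n => ∫⁻ z, F n z ∂μ) atTop := lintegral_liminf_le fun n => by fun_prop
    _ ≤ ENNReal.ofReal (2 * C) :=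
        (liminf_le_liminf hbound).trans (by simp)
    _ < ∞ := ENNReal.ofReal_lt_top

/-- Taylor's bound serves for |u| ≤ 1; for |u| > 1 the triangle inequality gives 2|u| ≤ 2u². The
constant 3 is not optimal, but one global bound is what domination under ν requires. -/
lemma norm_exp_I_mul_sub_one_sub_le (u : ℝ) :
    ‖Complex.exp (Complex.I * u) - 1 - Complex.I * u‖ ≤ 3 * u ^ 2 := by
  have hn : ‖Complex.I * (u : ℂ)‖ = |u| := by simp
  by_cases hu : |u| ≤ 1
  · have := Complex.norm_exp_sub_one_sub_id_le (x := Complex.I * u) (by rw [hn]; exact hu)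
    rw [hn, sq_abs] at this
    nlinarith [sq_nonneg u]
  · push Not at hu
    have h1 := Real.norm_exp_I_mul_ofReal_sub_one_le (x := u)
    have h2 := norm_sub_le (Complex.exp (Complex.I * u) - 1) (Complex.I * u)
    rw [hn] at h2
    rw [Real.norm_eq_abs] at h1
    nlinarith [sq_abs u]

/-- The compensated part is at most 3θ²z² and the uncompensated part at most 2, so a multiple of
min(1, z²) dominates both. -/
lemma integrable_levyExponent_integrand {ν : Measure ℝ} (hν : IsLevyMeasure ν) (θ : ℝ) :
    Integrable (fun z : ℝ => Complex.exp (Complex.I * θ * z) - 1 -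
      if |z| ≤ 1 then Complex.I * θ * z else 0) ν := by
  have hm : Integrable (fun z : ℝ => (2 + 3 * θ ^ 2) * min 1 (z ^ 2)) ν := by
    refine Integrable.const_mul ⟨by fun_prop, ?_⟩ _
    rw [hasFiniteIntegral_iff_ofReal (Eventually.of_forall fun z => by positivity)]
    exact hν.lintegral_lt_top
  refine hm.mono' ?_ (Eventually.of_forall fun z => ?_)
  · refine (Measurable.sub (by fun_prop) (Measurable.ite ?_ (by fun_prop) (by fun_prop)))
      |>.aestronglyMeasurable
    exact measurableSet_le (by fun_prop) (by fun_prop)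
  · split_ifs with hz
    · have h := norm_exp_I_mul_sub_one_sub_le (θ * z)
      have hz2 : z ^ 2 ≤ 1 := by rw [← sq_abs]; nlinarith [abs_nonneg z]
      rw [min_eq_right hz2]
      push_cast at h
      rw [← mul_assoc] at h
      nlinarith [sq_nonneg z]
    · push Not at hz
      have hz2 : 1 ≤ z ^ 2 := by rw [← sq_abs]; nlinarith [abs_nonneg z]
      rw [min_eq_left hz2, sub_zero]
      refine (norm_sub_le _ _).trans ?_
      have : ‖Complex.exp (Complex.I * θ * z)‖ = 1 := by
        rw [show Complex.I * (θ : ℂ) * z = ((θ * z : ℝ) : ℂ) * Complex.I by push_cast; ring]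
        exact Complex.norm_exp_ofReal_mul_I _
      rw [this]
      norm_num
      nlinarith [sq_nonneg θ]

/-- Drift and compensator are purely imaginary; only the Gaussian term and the cosine survive. -/
lemma levyExponent_re {ν : Measure ℝ} (hν : IsLevyMeasure ν) (a b θ : ℝ) :
    (levyExponent a b ν θ).re = -(θ ^ 2 * b / 2) - ∫ z, (1 - Real.cos (θ * z)) ∂ν := by
  have hre (z : ℝ) : (Complex.exp (Complex.I * θ * z) - 1 -
      if |z| ≤ 1 then Complex.I * θ * z else 0).re = -(1 - Real.cos (θ * z)) := by
    have h1 : (if |z| ≤ 1 then Complex.I * (θ : ℂ) * z else 0).re = 0 := by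
      split_ifs <;> simp
    have h2 : (Complex.exp (Complex.I * θ * z)).re = Real.cos (θ * z) := by
      rw [show Complex.I * (θ : ℂ) * z = ((θ * z : ℝ) : ℂ) * Complex.I by push_cast; ring]
      exact Complex.exp_ofReal_mul_I_re _
    rw [Complex.sub_re, Complex.sub_re, h1, h2]
    simp
  have hint : (∫ z : ℝ, (Complex.exp (Complex.I * θ * z) - 1 -
      if |z| ≤ 1 then Complex.I * θ * z else 0) ∂ν).re = -∫ z, (1 - Real.cos (θ * z)) ∂ν := by
    rw [← RCLike.re_eq_complex_re, ← integral_re (integrable_levyExponent_integrand hν θ),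
      ← integral_neg]
    exact integral_congr_ae (Eventually.of_forall hre)
  rw [levyExponent, Complex.add_re, hint, Complex.sub_re]
  have h1 : (Complex.I * (θ : ℂ) * a).re = 0 := by simp
  have h2 : ((θ : ℂ) ^ 2 * b / 2).re = θ ^ 2 * b / 2 := by
    rw [show (θ : ℂ) ^ 2 * b / 2 = ((θ ^ 2 * b / 2 : ℝ) : ℂ) by push_cast; ring]
    exact Complex.ofReal_re _
  rw [h1, h2]
  ring

lemma integrable_one_sub_cos {ν : Measure ℝ} (hν : IsLevyMeasure ν) (θ : ℝ) :
    Integrable (fun z : ℝ => 1 - Real.cos (θ * z)) ν := by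
  have h := (integrable_levyExponent_integrand hν θ).re.neg
  refine h.congr (Eventually.of_forall fun z => ?_)
  have h1 : (if |z| ≤ 1 then Complex.I * (θ : ℂ) * z else 0).re = 0 := by
    split_ifs <;> simp
  have h2 : (Complex.exp (Complex.I * θ * z)).re = Real.cos (θ * z) := by
    rw [show Complex.I * (θ : ℂ) * z = ((θ * z : ℝ) : ℂ) * Complex.I by push_cast; ring]
    exact Complex.exp_ofReal_mul_I_re _
  simp only [Pi.neg_apply, RCLike.re_eq_complex_re]
  rw [Complex.sub_re, Complex.sub_re, h1, h2]
  simp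

lemma charFun_re (μ : Measure ℝ) [IsProbabilityMeasure μ] (θ : ℝ) :
    (charFun μ θ).re = ∫ x, Real.cos (θ * x) ∂μ := by
  have hi : Integrable (fun x : ℝ => Complex.exp (θ * x * Complex.I)) μ := by
    refine (integrable_const (1 : ℝ)).mono' (by fun_prop) (Eventually.of_forall fun x => ?_)
    rw [← Complex.ofReal_mul, Complex.norm_exp_ofReal_mul_I]
  rw [charFun_apply_real, ← RCLike.re_eq_complex_re, ← integral_re hi]
  refine integral_congr_ae (Eventually.of_forall fun x => ?_)
  simp only [RCLike.re_eq_complex_re]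
  rw [← Complex.ofReal_mul, Complex.exp_ofReal_mul_I_re]

/-- The Lévy measure of an infinitely divisible law with finite second moment has a finite second
moment. -/
lemma integrable_sq_levyMeasure {μ : Measure ℝ} [IsProbabilityMeasure μ]
    (hμ : Integrable (fun x : ℝ => x ^ 2) μ) {a b c : ℝ} {ν : Measure ℝ} (hb : 0 ≤ b)
    (hν : IsLevyMeasure ν) (hc : 0 < c)
    (hφ : ∀ θ : ℝ, charFun μ θ = Complex.exp (c * levyExponent a b ν θ)) :
    Integrable (fun z : ℝ => z ^ 2) ν := by
  set K : ℝ := ∫ x, x ^ 2 ∂μ with hK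
  have hK0 : 0 ≤ K := integral_nonneg fun x => sq_nonneg x
  refine integrable_sq_of_lintegral_one_sub_cos_le ν (C := K / c) ?_
  -- With q = θ²K/2 < 1/2, the inequality (1 - q)(1 + cJ) ≤ 1 proved below gives cJ ≤ 2q = θ²K,
  -- whence the constant K / c.
  have hsmall : ∀ᶠ θ in 𝓝 (0 : ℝ), θ ^ 2 * K / 2 < 1 / 2 := by
    have : Continuous fun θ : ℝ => θ ^ 2 * K / 2 := by fun_prop
    exact this.continuousAt.eventually_lt continuousAt_const (by norm_num)
  filter_upwards [hsmall] with θ hθ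
  have h0 (z : ℝ) : 0 ≤ 1 - Real.cos (θ * z) := sub_nonneg.2 (Real.cos_le_one _)
  rw [← ofReal_integral_eq_lintegral_ofReal (integrable_one_sub_cos hν θ)
    (Eventually.of_forall h0)]
  refine ENNReal.ofReal_le_ofReal ?_
  set J := ∫ z, (1 - Real.cos (θ * z)) ∂ν with hJ
  have hJ0 : 0 ≤ J := integral_nonneg h0
  have hlow : 1 - θ ^ 2 * K / 2 ≤ (charFun μ θ).re := by
    rw [charFun_re]
    have hcos : Integrable (fun x : ℝ => Real.cos (θ * x)) μ :=
      (integrable_const (1 : ℝ)).mono' (by fun_prop)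
        (Eventually.of_forall fun x => by simpa using Real.abs_cos_le_one _)
    have : ∫ x, (1 - θ ^ 2 / 2 * x ^ 2) ∂μ = 1 - θ ^ 2 * K / 2 := by
      rw [integral_sub (integrable_const _) (hμ.const_mul _), integral_const_mul, ← hK]
      simp
      ring
    rw [← this]
    refine integral_mono ((integrable_const _).sub (hμ.const_mul _)) hcos fun x => ?_
    have := Real.one_sub_sq_div_two_le_cos (x := θ * x)
    simp only
    nlinarith
  -- The Gaussian factor is at most 1 because b ≥ 0, and is dropped.
  have hup : (charFun μ θ).re ≤ Real.exp (-(c * J)) := by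
    refine (Complex.re_le_norm _).trans ?_
    rw [hφ, Complex.norm_exp]
    refine Real.exp_le_exp.2 ?_
    rw [Complex.re_ofReal_mul, levyExponent_re hν, ← hJ]
    have : 0 ≤ c * (θ ^ 2 * b / 2) := by positivity
    nlinarith
  have h1 : (1 - θ ^ 2 * K / 2) * (1 + c * J) ≤ 1 := by
    have hcJ : 0 ≤ c * J := by positivity
    calc (1 - θ ^ 2 * K / 2) * (1 + c * J) ≤ Real.exp (-(c * J)) * Real.exp (c * J) := by
          gcongr
          · exact hlow.trans hup
          · linarith [Real.add_one_le_exp (c * J)]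
      _ = 1 := by rw [← Real.exp_add]; simp
  rw [div_mul_eq_mul_div, le_div_iff₀ hc]
  nlinarith [mul_nonneg hc.le hJ0]

/-! ### Differentiating the Lévy–Khintchine exponent; mean and variance -/

section SecondMoment

variable {ν : Measure ℝ}

lemma integrableOn_id_of_integrable_sq (hν2 : Integrable (fun z : ℝ => z ^ 2) ν) :
    IntegrableOn (fun z : ℝ => z) {z | 1 < |z|} ν := by
  refine (hν2.integrableOn (s := {z | 1 < |z|})).mono' (by fun_prop) ?_
  refine (ae_restrict_iff' (measurableSet_lt (by fun_prop) (by fun_prop))).2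
    (Eventually.of_forall fun z hz => ?_)
  have hz : 1 < |z| := hz
  rw [Real.norm_eq_abs, ← sq_abs]
  nlinarith

lemma integrable_exp_sub_one_sub (hν2 : Integrable (fun z : ℝ => z ^ 2) ν) (θ : ℝ) :
    Integrable (fun z : ℝ => Complex.exp (Complex.I * θ * z) - 1 - Complex.I * θ * z) ν := by
  refine (hν2.const_mul (3 * θ ^ 2)).mono' (by fun_prop) (Eventually.of_forall fun z => ?_)
  have h := norm_exp_I_mul_sub_one_sub_le (θ * z)
  push_cast at h
  rw [← mul_assoc] at h
  refine h.trans (le_of_eq (by ring))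

/-- A finite second moment makes z integrable over |z| > 1, so the compensator may be extended to
the whole line. The correction moves into the drift; this is where the term ∫_{|z|>1} z dν of the
mean originates. -/
lemma levyExponent_eq_of_integrable_sq (hν2 : Integrable (fun z : ℝ => z ^ 2) ν) (a b θ : ℝ) :
    levyExponent a b ν θ = Complex.I * θ * (a + ∫ z in {z : ℝ | 1 < |z|}, z ∂ν : ℝ)
      - (θ : ℂ) ^ 2 * b / 2
      + ∫ z : ℝ, (Complex.exp (Complex.I * θ * z) - 1 - Complex.I * θ * z) ∂ν := by
  have hS : MeasurableSet {z : ℝ | 1 < |z|} := measurableSet_lt (by fun_prop) (by fun_prop)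
  have hi := integrableOn_id_of_integrable_sq hν2
  have hi' : Integrable (fun z : ℝ => ({z : ℝ | 1 < |z|}.indicator (fun z => (z : ℂ)) z)) ν :=
    (integrable_indicator_iff hS).2 hi.ofReal
  have key : ∫ z : ℝ, (Complex.exp (Complex.I * θ * z) - 1 -
      if |z| ≤ 1 then Complex.I * θ * z else 0) ∂ν
      = ∫ z : ℝ, (Complex.exp (Complex.I * θ * z) - 1 - Complex.I * θ * z) ∂ν
        + Complex.I * θ * (∫ z in {z : ℝ | 1 < |z|}, z ∂ν : ℝ) := by
    rw [← integral_complex_ofReal, ← integral_indicator hS, ← integral_const_mul,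
      ← integral_add (integrable_exp_sub_one_sub hν2 θ) (hi'.const_mul _)]
    refine integral_congr_ae (Eventually.of_forall fun z => ?_)
    by_cases hz : |z| ≤ 1
    · simp [hz]
    · simp [hz, not_le.1 hz]
  rw [levyExponent, key]
  push_cast
  ring

lemma hasDerivAt_integral_exp_sub_one_sub (hν2 : Integrable (fun z : ℝ => z ^ 2) ν) (θ : ℝ) :
    HasDerivAt (fun θ : ℝ =>
        ∫ z : ℝ, (Complex.exp (Complex.I * θ * z) - 1 - Complex.I * θ * z) ∂ν)
      (∫ z : ℝ, Complex.I * z * (Complex.exp (Complex.I * θ * z) - 1) ∂ν) θ := by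
  refine (hasDerivAt_integral_of_dominated_loc_of_deriv_le
    (F := fun (θ : ℝ) (z : ℝ) => Complex.exp (Complex.I * θ * z) - 1 - Complex.I * θ * z)
    (F' := fun (θ : ℝ) (z : ℝ) => Complex.I * z * (Complex.exp (Complex.I * θ * z) - 1))
    (bound := fun z => (|θ| + 1) * z ^ 2) (Metric.ball_mem_nhds θ one_pos)
    (Eventually.of_forall fun _ => by fun_prop) (integrable_exp_sub_one_sub hν2 θ) (by fun_prop)
    (Eventually.of_forall fun z x hx => ?_) (hν2.const_mul _)
    (Eventually.of_forall fun z x _ => ?_)).2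
  · have h1 := Real.norm_exp_I_mul_ofReal_sub_one_le (x := x * z)
    push_cast at h1
    rw [← mul_assoc] at h1
    rw [norm_mul, norm_mul, Complex.norm_I, one_mul, Complex.norm_real, Real.norm_eq_abs]
    rw [Real.norm_eq_abs, abs_mul] at h1
    have hx' : |x| ≤ |θ| + 1 := by
      have h2 := abs_sub_abs_le_abs_sub x θ
      rw [Metric.mem_ball, Real.dist_eq] at hx
      linarith
    calc |z| * ‖Complex.exp (Complex.I * x * z) - 1‖ ≤ |z| * (|x| * |z|) := by gcongr
      _ = |x| * z ^ 2 := by rw [← sq_abs z]; ring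
      _ ≤ (|θ| + 1) * z ^ 2 := by gcongr
  · have hlin : HasDerivAt (fun x : ℝ => Complex.I * (x : ℂ) * z) (Complex.I * z) x := by
      simpa using (((hasDerivAt_id (x : ℂ)).const_mul Complex.I).mul_const (z : ℂ)).comp_ofReal
    refine ((hlin.cexp.sub_const 1).sub hlin).congr_deriv ?_
    ring

/-- Differentiation under the integral, dominated by z². Only the point 0 is treated: there the
integrand itself vanishes, so its integrability is free. -/
lemma hasDerivAt_integral_mul_exp_sub_one (hν2 : Integrable (fun z : ℝ => z ^ 2) ν) :
    HasDerivAt (fun θ : ℝ => ∫ z : ℝ, Complex.I * z * (Complex.exp (Complex.I * θ * z) - 1) ∂ν)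
      (-(∫ z, z ^ 2 ∂ν : ℝ) : ℂ) 0 := by
  have hval : ∫ z : ℝ, -((z : ℂ) ^ 2) * Complex.exp (Complex.I * (0 : ℝ) * z) ∂ν
      = (-(∫ z, z ^ 2 ∂ν : ℝ) : ℂ) := by
    rw [← integral_complex_ofReal, ← integral_neg]
    refine integral_congr_ae (Eventually.of_forall fun z => ?_)
    simp
  rw [← hval]
  refine (hasDerivAt_integral_of_dominated_loc_of_deriv_le
    (F := fun (θ : ℝ) (z : ℝ) => Complex.I * z * (Complex.exp (Complex.I * θ * z) - 1))
    (F' := fun (θ : ℝ) (z : ℝ) => -((z : ℂ) ^ 2) * Complex.exp (Complex.I * θ * z))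
    (bound := fun z => z ^ 2) (Metric.ball_mem_nhds 0 one_pos)
    (Eventually.of_forall fun _ => by fun_prop) (by simp) (Measurable.aestronglyMeasurable (by fun_prop))
    (Eventually.of_forall fun z x hx => ?_) hν2
    (Eventually.of_forall fun z x _ => ?_)).2
  · rw [show Complex.I * (x : ℂ) * z = ((x * z : ℝ) : ℂ) * Complex.I by push_cast; ring, norm_mul,
      Complex.norm_exp_ofReal_mul_I]
    simp
  · have hlin : HasDerivAt (fun x : ℝ => Complex.I * (x : ℂ) * z) (Complex.I * z) x := by
      simpa using (((hasDerivAt_id (x : ℂ)).const_mul Complex.I).mul_const (z : ℂ)).comp_ofReal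
    refine ((hlin.cexp.sub_const 1).const_mul (Complex.I * (z : ℂ))).congr_deriv ?_
    linear_combination ((z : ℂ) ^ 2 * Complex.exp (Complex.I * x * z)) * Complex.I_sq

/-- The derivative of the Lévy–Khintchine exponent when the Lévy measure has a finite second
moment. -/
lemma hasDerivAt_levyExponent (hν2 : Integrable (fun z : ℝ => z ^ 2) ν) (a b θ : ℝ) :
    HasDerivAt (levyExponent a b ν)
      (Complex.I * (a + ∫ z in {z : ℝ | 1 < |z|}, z ∂ν : ℝ) - θ * b
        + ∫ z : ℝ, Complex.I * z * (Complex.exp (Complex.I * θ * z) - 1) ∂ν) θ := by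
  rw [funext (levyExponent_eq_of_integrable_sq hν2 a b)]
  refine HasDerivAt.add (HasDerivAt.sub ?_ ?_) (hasDerivAt_integral_exp_sub_one_sub hν2 θ)
  · simpa using (((hasDerivAt_id (θ : ℂ)).const_mul Complex.I).mul_const
      ((a + ∫ z in {z : ℝ | 1 < |z|}, z ∂ν : ℝ) : ℂ)).comp_ofReal
  · have h := ((((hasDerivAt_id (θ : ℂ)).pow 2).mul_const (b : ℂ)).div_const 2).comp_ofReal
    refine h.congr_deriv ?_
    simp
    ring

lemma levyExponent_zero (a b : ℝ) : levyExponent a b ν 0 = 0 := by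
  simp [levyExponent]

/-- Mean and second moment of a square integrable law with characteristic function
`exp (c ψ(θ))`. -/
lemma moments_of_charFun_eq {μ : Measure ℝ} [IsProbabilityMeasure μ] (hμ : MemLp id 2 μ)
    (hν2 : Integrable (fun z : ℝ => z ^ 2) ν) {a b c : ℝ}
    (hφ : ∀ θ : ℝ, charFun μ θ = Complex.exp (c * levyExponent a b ν θ)) :
    ∫ x, x ∂μ = c * (a + ∫ z in {z : ℝ | 1 < |z|}, z ∂ν) ∧
    ∫ x, x ^ 2 ∂μ = c * (b + ∫ z, z ^ 2 ∂ν) + (c * (a + ∫ z in {z : ℝ | 1 < |z|}, z ∂ν)) ^ 2 := by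
  set m : ℝ := a + ∫ z in {z : ℝ | 1 < |z|}, z ∂ν with hm
  set M : ℝ := ∫ z, z ^ 2 ∂ν with hM
  set D : ℝ → ℂ := fun θ => Complex.I * m - θ * b
    + ∫ z : ℝ, Complex.I * z * (Complex.exp (Complex.I * θ * z) - 1) ∂ν with hD
  have hφ' : charFun μ = fun θ => Complex.exp (c * levyExponent a b ν θ) := funext hφ
  have hd1 (θ : ℝ) : HasDerivAt (charFun μ)
      (Complex.exp (c * levyExponent a b ν θ) * (c * D θ)) θ := by
    rw [hφ']
    exact ((hasDerivAt_levyExponent hν2 a b θ).const_mul (c : ℂ)).cexp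
  have hD0 : D 0 = Complex.I * m := by simp [hD]
  have hd1' : deriv (charFun μ) = fun θ => Complex.exp (c * levyExponent a b ν θ) * (c * D θ) :=
    funext fun θ => (hd1 θ).deriv
  have hDd : HasDerivAt D (-b + -(M : ℂ)) 0 := by
    refine HasDerivAt.add ?_ (hasDerivAt_integral_mul_exp_sub_one hν2)
    simpa using ((((hasDerivAt_id ((0 : ℝ) : ℂ)).mul_const (b : ℂ)).const_sub
      (Complex.I * m)).comp_ofReal)
  have hd2 : HasDerivAt (deriv (charFun μ))
      (c * D 0 * (c * D 0) + c * (-b + -(M : ℂ))) 0 := by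
    rw [hd1']
    have h := (((hasDerivAt_levyExponent hν2 a b 0).const_mul (c : ℂ)).cexp).mul
      (hDd.const_mul (c : ℂ))
    refine h.congr_deriv ?_
    simp only [levyExponent_zero, mul_zero, Complex.exp_zero, one_mul]
    rfl
  -- The derivatives of the characteristic function at 0 are powers of i times moments; they are
  -- compared with those of exp(cψ), where ψ(0) = 0 and D = ψ'.
  have e1 := iteratedDeriv_charFun_zero (n := 1) (μ := μ) (by
    simpa using hμ.mono_exponent (p := 1) (by norm_num))
  have e2 := iteratedDeriv_charFun_zero (n := 2) (μ := μ) (by simpa using hμ)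
  rw [iteratedDeriv_one, (hd1 0).deriv, hD0, levyExponent_zero] at e1
  rw [iteratedDeriv_succ, iteratedDeriv_one, hd2.deriv, hD0] at e2
  simp only [mul_zero, Complex.exp_zero, one_mul, pow_one] at e1
  constructor
  · have h : Complex.I * ((∫ x, x ∂μ : ℝ) : ℂ) = Complex.I * ((c * m : ℝ) : ℂ) := by
      rw [← e1]; push_cast; ring
    exact_mod_cast mul_left_cancel₀ Complex.I_ne_zero h
  · have h : ((∫ x, x ^ 2 ∂μ : ℝ) : ℂ) = ((c * (b + M) + (c * m) ^ 2 : ℝ) : ℂ) := by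
      push_cast
      linear_combination e2 - (c ^ 2 * m ^ 2 - ((∫ x, x ^ 2 ∂μ : ℝ) : ℂ)) * Complex.I_sq
    exact_mod_cast h

/-- A law with characteristic function `exp ψ(θ)` is square integrable if the Lévy measure has a
finite second moment. -/
lemma integrable_sq_of_charFun_eq {μ : Measure ℝ} [IsProbabilityMeasure μ]
    (hν2 : Integrable (fun z : ℝ => z ^ 2) ν) {a b : ℝ}
    (hφ : ∀ θ : ℝ, charFun μ θ = Complex.exp (levyExponent a b ν θ)) :
    Integrable (fun x : ℝ => x ^ 2) μ := by
  set m : ℝ := a + ∫ z in {z : ℝ | 1 < |z|}, z ∂ν with hm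
  set M : ℝ := ∫ z, z ^ 2 ∂ν with hM
  set Q : ℝ := |b| / 2 + 3 * M with hQ
  have hM0 : 0 ≤ M := integral_nonneg fun x => sq_nonneg x
  have hQ0 : 0 ≤ Q := by positivity
  have hrem (θ : ℝ) : ‖levyExponent a b ν θ - Complex.I * θ * m‖ ≤ Q * θ ^ 2 := by
    rw [levyExponent_eq_of_integrable_sq hν2 a b θ, ← hm]
    have h1 : ‖∫ z : ℝ, (Complex.exp (Complex.I * θ * z) - 1 - Complex.I * θ * z) ∂ν‖
        ≤ 3 * θ ^ 2 * M := by
      rw [hM, ← integral_const_mul]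
      refine norm_integral_le_of_norm_le (hν2.const_mul _) (Eventually.of_forall fun z => ?_)
      have h := norm_exp_I_mul_sub_one_sub_le (θ * z)
      push_cast at h
      rw [← mul_assoc] at h
      refine h.trans (le_of_eq (by ring))
    have h2 : ‖(θ : ℂ) ^ 2 * b / 2‖ = θ ^ 2 * |b| / 2 := by simp
    set R := ∫ z : ℝ, (Complex.exp (Complex.I * θ * z) - 1 - Complex.I * θ * z) ∂ν
    calc ‖Complex.I * θ * m - (θ : ℂ) ^ 2 * b / 2 + R - Complex.I * θ * m‖
        = ‖R - (θ : ℂ) ^ 2 * b / 2‖ := by congr 1; ring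
      _ ≤ 3 * θ ^ 2 * M + θ ^ 2 * |b| / 2 := (norm_sub_le _ _).trans (by rw [h2]; gcongr)
      _ = Q * θ ^ 2 := by rw [hQ]; ring
  -- With w = ψ(θ), 1 - Re e^w ≤ -Re w + |w|² for |w| ≤ 1. The summand Q comes from Re w and the
  -- square from |w| ≤ (|m| + Q)|θ|.
  refine integrable_sq_of_lintegral_one_sub_cos_le μ (C := Q + (|m| + Q) ^ 2) ?_
  have hs1 : ∀ᶠ θ in 𝓝 (0 : ℝ), (|m| + Q) * |θ| < 1 := by
    have : Continuous fun θ : ℝ => (|m| + Q) * |θ| := by fun_prop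
    exact this.continuousAt.eventually_lt continuousAt_const (by norm_num)
  have hs2 : ∀ᶠ θ in 𝓝 (0 : ℝ), |θ| < 1 := by
    exact continuous_abs.continuousAt.eventually_lt continuousAt_const (by norm_num)
  filter_upwards [hs1, hs2] with θ hθ hθ1
  have hcos : Integrable (fun x : ℝ => Real.cos (θ * x)) μ :=
    (integrable_const (1 : ℝ)).mono' (by fun_prop)
      (Eventually.of_forall fun x => by simpa using Real.abs_cos_le_one _)
  rw [← ofReal_integral_eq_lintegral_ofReal (f := fun x => 1 - Real.cos (θ * x))
    ((integrable_const 1).sub hcos) (Eventually.of_forall fun z => sub_nonneg.2 (Real.cos_le_one _))]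
  refine ENNReal.ofReal_le_ofReal ?_
  rw [integral_sub (integrable_const _) hcos, ← charFun_re, hφ]
  simp only [integral_const, probReal_univ, smul_eq_mul, mul_one]
  set w := levyExponent a b ν θ with hw
  have hwr := hrem θ
  rw [← hw] at hwr
  have hwn : ‖w‖ ≤ (|m| + Q) * |θ| := by
    have h3 : ‖Complex.I * (θ : ℂ) * m‖ = |θ| * |m| := by simp
    have h4 : w = (w - Complex.I * θ * m) + Complex.I * θ * m := by ring
    rw [h4]
    refine (norm_add_le _ _).trans ?_
    rw [h3]
    have : Q * θ ^ 2 ≤ Q * |θ| := by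
      rw [← sq_abs]
      gcongr
      nlinarith [abs_nonneg θ]
    linarith
  -- The first-order term iθm is imaginary, so the real part is already quadratic in θ.
  have hre : |w.re| ≤ Q * θ ^ 2 := by
    have h := (Complex.abs_re_le_norm _).trans hwr
    simpa using h
  have hexp := (Complex.abs_re_le_norm _).trans
    (Complex.norm_exp_sub_one_sub_id_le (x := w) (hwn.trans hθ.le))
  have hsq : ‖w‖ ^ 2 ≤ (|m| + Q) ^ 2 * θ ^ 2 := by
    rw [← sq_abs θ, ← mul_pow]
    gcongr
  simp only [Complex.sub_re, Complex.one_re] at hexp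
  have := abs_le.1 hexp
  have := abs_le.1 hre
  linarith

end SecondMoment

end MSTOU

namespace MSTOU

/-! ### Limits in L² and in probability; the combined L¹ and L² seminorm -/

section General

variable {α : Type*} [MeasurableSpace α] {μ : Measure α}

lemma eLpNorm_two_eq_ofReal_sqrt {X : α → ℝ} (hX : MemLp X 2 μ) :
    eLpNorm X 2 μ = ENNReal.ofReal (√(∫ x, X x ^ 2 ∂μ)) := by
  rw [hX.eLpNorm_eq_integral_rpow_norm (by norm_num) (by norm_num), Real.sqrt_eq_rpow]
  simp

/-- Joint continuity of the L² inner product. It is used both on the probability space and for the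
control measure. -/
lemma tendsto_integral_mul_of_tendsto_eLpNorm {X X' : ℕ → α → ℝ} {Y Y' : α → ℝ}
    (hX : ∀ n, MemLp (X n) 2 μ) (hX' : ∀ n, MemLp (X' n) 2 μ) (hY : MemLp Y 2 μ)
    (hY' : MemLp Y' 2 μ) (h : Tendsto (fun n => eLpNorm (X n - Y) 2 μ) atTop (𝓝 0))
    (h' : Tendsto (fun n => eLpNorm (X' n - Y') 2 μ) atTop (𝓝 0)) :
    Tendsto (fun n => ∫ x, X n x * X' n x ∂μ) atTop (𝓝 (∫ x, Y x * Y' x ∂μ)) := by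
  have hin {U V : α → ℝ} (hU : MemLp U 2 μ) (hV : MemLp V 2 μ) :
      inner ℝ (hV.toLp V) (hU.toLp U) = ∫ x, U x * V x ∂μ := by
    rw [L2.inner_def]
    refine integral_congr_ae ?_
    filter_upwards [hU.coeFn_toLp, hV.coeFn_toLp] with x h1 h2
    rw [h1, h2]
    rfl
  have t := (Lp.tendsto_Lp_iff_tendsto_eLpNorm'' X hX Y hY).2 h
  have t' := (Lp.tendsto_Lp_iff_tendsto_eLpNorm'' X' hX' Y' hY').2 h'
  have := t'.inner (𝕜 := ℝ) t
  simpa only [hin] using this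

lemma tendsto_integral_of_tendsto_eLpNorm_two [IsProbabilityMeasure μ] {X : ℕ → α → ℝ} {Y : α → ℝ}
    (hX : ∀ n, MemLp (X n) 2 μ) (hY : MemLp Y 2 μ)
    (h : Tendsto (fun n => eLpNorm (X n - Y) 2 μ) atTop (𝓝 0)) :
    Tendsto (fun n => ∫ x, X n x ∂μ) atTop (𝓝 (∫ x, Y x ∂μ)) := by
  have := tendsto_integral_mul_of_tendsto_eLpNorm hX (fun _ => memLp_const (1 : ℝ)) hY
    (memLp_const (1 : ℝ)) h (by simp)
  simpa using this

lemma tendsto_covariance_of_tendsto_eLpNorm [IsProbabilityMeasure μ] {X X' : ℕ → α → ℝ}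
    {Y Y' : α → ℝ} (hX : ∀ n, MemLp (X n) 2 μ) (hX' : ∀ n, MemLp (X' n) 2 μ) (hY : MemLp Y 2 μ)
    (hY' : MemLp Y' 2 μ) (h : Tendsto (fun n => eLpNorm (X n - Y) 2 μ) atTop (𝓝 0))
    (h' : Tendsto (fun n => eLpNorm (X' n - Y') 2 μ) atTop (𝓝 0)) :
    Tendsto (fun n => cov[X n, X' n; μ]) atTop (𝓝 cov[Y, Y'; μ]) := by
  rw [covariance_eq_sub hY hY']
  simp_rw [fun n => covariance_eq_sub (hX n) (hX' n)]
  exact (tendsto_integral_mul_of_tendsto_eLpNorm hX hX' hY hY' h h').sub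
    ((tendsto_integral_of_tendsto_eLpNorm_two hX hY h).mul
      (tendsto_integral_of_tendsto_eLpNorm_two hX' hY' h'))

lemma tendstoInMeasure_add {X X' : ℕ → α → ℝ} {Y Y' : α → ℝ}
    (h : TendstoInMeasure μ X atTop Y) (h' : TendstoInMeasure μ X' atTop Y') :
    TendstoInMeasure μ (fun n => X n + X' n) atTop (Y + Y') := by
  rw [tendstoInMeasure_iff_norm] at *
  intro ε hε
  have hsum := (h (ε / 2) (by positivity)).add (h' (ε / 2) (by positivity))
  rw [add_zero] at hsum
  refine tendsto_of_tendsto_of_tendsto_of_le_of_le tendsto_const_nhds hsum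
    (fun _ => zero_le) fun n => ?_
  refine (measure_mono fun x hx => ?_).trans (measure_union_le _ _)
  simp only [Set.mem_ofPred_eq, Set.mem_union, Pi.add_apply] at hx ⊢
  by_contra! hc
  have := norm_add_le (X n x - Y x) (X' n x - Y' x)
  rw [show X n x - Y x + (X' n x - Y' x) = X n x + X' n x - (Y x + Y' x) by ring] at this
  linarith [hc.1, hc.2]

lemma tendstoInMeasure_const_sub {X : ℕ → α → ℝ} {Y : α → ℝ} (Z : α → ℝ)
    (h : TendstoInMeasure μ X atTop Y) :
    TendstoInMeasure μ (fun n => Z - X n) atTop (Z - Y) := by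
  rw [tendstoInMeasure_iff_norm] at *
  intro ε hε
  refine (h ε hε).congr fun n => ?_
  congr 1
  ext x
  simp only [Set.mem_ofPred_eq, Pi.sub_apply]
  rw [← norm_neg]
  congr! 2
  ring

/-- The sum of the `L¹` and the `L²` seminorm. -/
noncomputable def sumNorm (μ : Measure α) (φ : α → ℝ) : ℝ≥0∞ := eLpNorm φ 1 μ + eLpNorm φ 2 μ

lemma sumNorm_add_le {φ ψ : α → ℝ} (hφ : AEStronglyMeasurable φ μ)
    (hψ : AEStronglyMeasurable ψ μ) : sumNorm μ (φ + ψ) ≤ sumNorm μ φ + sumNorm μ ψ := by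
  unfold sumNorm
  calc _ ≤ (eLpNorm φ 1 μ + eLpNorm ψ 1 μ) + (eLpNorm φ 2 μ + eLpNorm ψ 2 μ) :=
        add_le_add (eLpNorm_add_le hφ hψ le_rfl) (eLpNorm_add_le hφ hψ (by norm_num))
    _ = _ := by ring

lemma sumNorm_sub_le {φ ψ : α → ℝ} (hφ : AEStronglyMeasurable φ μ)
    (hψ : AEStronglyMeasurable ψ μ) : sumNorm μ (φ - ψ) ≤ sumNorm μ φ + sumNorm μ ψ := by
  unfold sumNorm
  calc _ ≤ (eLpNorm φ 1 μ + eLpNorm ψ 1 μ) + (eLpNorm φ 2 μ + eLpNorm ψ 2 μ) :=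
        add_le_add (eLpNorm_sub_le hφ hψ le_rfl) (eLpNorm_sub_le hφ hψ (by norm_num))
    _ = _ := by ring

lemma sumNorm_mono {φ ψ : α → ℝ} (h : ∀ x, ‖φ x‖ ≤ ‖ψ x‖) : sumNorm μ φ ≤ sumNorm μ ψ :=
  add_le_add (eLpNorm_mono h) (eLpNorm_mono h)

end General

/-! ### Second order structure of a Lévy basis -/

variable {d : ℕ} {Ω : Type*} [MeasurableSpace Ω] {P : Measure Ω}
  {𝓑 : Set (Set (Pt d))} {L : Set (Pt d) → Ω → ℝ} {c : Measure (Pt d)}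

/-- A random measure with orthogonal increments, mean measure `m c` and variance measure `v c`. -/
structure HasOrthogonalIncrements (P : Measure Ω) (𝓑 : Set (Set (Pt d)))
    (L : Set (Pt d) → Ω → ℝ) (c : Measure (Pt d)) (m v : ℝ) : Prop where
  memLp : ∀ E ∈ 𝓑, MemLp (L E) 2 P
  integral_eq : ∀ E ∈ 𝓑, ∫ ω, L E ω ∂P = m * c.real E
  covariance_eq : ∀ E ∈ 𝓑, ∀ F ∈ 𝓑, cov[L E, L F; P] = v * c.real (E ∩ F)

lemma IsBoundedClass.empty_mem (h𝓑 : IsBoundedClass c 𝓑) : (∅ : Set (Pt d)) ∈ 𝓑 :=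
  h𝓑.bounded_mem ∅ MeasurableSet.empty Bornology.isBounded_empty

/-- The sequence `E, F, ∅, ∅, …`. -/
def pairSeq (E F : Set (Pt d)) : ℕ → Set (Pt d)
  | 0 => E
  | 1 => F
  | _ + 2 => ∅

lemma pairwise_disjoint_pairSeq {E F : Set (Pt d)} (h : Disjoint E F) :
    Pairwise (Function.onFun Disjoint (pairSeq E F)) := by
  intro i j hij
  match i, j with
  | 0, 0 => exact absurd rfl hij
  | 1, 1 => exact absurd rfl hij
  | 0, 1 => exact h
  | 1, 0 => exact h.symm
  | _ + 2, _ => exact Set.empty_disjoint _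
  | _, _ + 2 => exact Set.disjoint_empty _

lemma iUnion_pairSeq (E F : Set (Pt d)) : ⋃ i, pairSeq E F i = E ∪ F := by
  ext x
  simp only [Set.mem_iUnion, Set.mem_union]
  constructor
  · rintro ⟨i, hi⟩
    match i with
    | 0 => exact Or.inl hi
    | 1 => exact Or.inr hi
    | _ + 2 => exact absurd hi (Set.notMem_empty x)
  · rintro (h | h)
    · exact ⟨0, h⟩
    · exact ⟨1, h⟩

lemma pairSeq_mem (h𝓑 : IsBoundedClass c 𝓑) {E F : Set (Pt d)} (hE : E ∈ 𝓑) (hF : F ∈ 𝓑) (i : ℕ) :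
    pairSeq E F i ∈ 𝓑 :=
  match i with
  | 0 => hE
  | 1 => hF
  | _ + 2 => h𝓑.empty_mem

/-- For the constant sequence ∅ the partial sums n L(∅) converge, so their increments L(∅) tend to
0. -/
lemma IsLevyBasis.empty_ae_eq_zero (hL : IsLevyBasis P 𝓑 L) (h𝓑 : IsBoundedClass c 𝓑) :
    ∀ᵐ ω ∂P, L ∅ ω = 0 := by
  have h := hL.sigma_additive (fun _ => ∅) (fun _ => h𝓑.empty_mem)
    (fun _ _ _ => Set.disjoint_empty _) (by simpa using h𝓑.empty_mem)
  filter_upwards [h] with ω hω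
  have h1 := ((tendsto_add_atTop_iff_nat 1).2 hω).sub hω
  simp only [Finset.sum_range_succ, add_sub_cancel_left, sub_self] at h1
  exact tendsto_nhds_unique tendsto_const_nhds h1

lemma IsLevyBasis.union_ae_eq (hL : IsLevyBasis P 𝓑 L) (h𝓑 : IsBoundedClass c 𝓑)
    {E F : Set (Pt d)} (hE : E ∈ 𝓑) (hF : F ∈ 𝓑) (hEF : Disjoint E F) :
    L (E ∪ F) =ᵐ[P] L E + L F := by
  have h := hL.sigma_additive (pairSeq E F) (pairSeq_mem h𝓑 hE hF)
    (pairwise_disjoint_pairSeq hEF) (by rw [iUnion_pairSeq]; exact h𝓑.union_mem E hE F hF)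
  rw [iUnion_pairSeq] at h
  filter_upwards [h, hL.empty_ae_eq_zero h𝓑] with ω hω h0
  refine tendsto_nhds_unique ((tendsto_add_atTop_iff_nat 2).2 hω)
    (tendsto_const_nhds.congr fun n => ?_)
  rw [add_comm n 2, Finset.sum_range_add]
  simp [Finset.sum_range_succ, pairSeq, add_comm 2, h0]

lemma IsLevyBasis.indepFun (hL : IsLevyBasis P 𝓑 L) (h𝓑 : IsBoundedClass c 𝓑)
    {E F : Set (Pt d)} (hE : E ∈ 𝓑) (hF : F ∈ 𝓑) (hEF : Disjoint E F) :
    IndepFun (L E) (L F) P :=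
  hL.indep (pairSeq E F) (pairSeq_mem h𝓑 hE hF) (pairwise_disjoint_pairSeq hEF) 0 1 zero_ne_one

lemma covariance_congr_ae {X X' Y Y' : Ω → ℝ} (h : X =ᵐ[P] X') (h' : Y =ᵐ[P] Y') :
    cov[X, Y; P] = cov[X', Y'; P] := by
  unfold covariance
  rw [integral_congr_ae h, integral_congr_ae h']
  refine integral_congr_ae ?_
  filter_upwards [h, h'] with ω h1 h2
  rw [h1, h2]

lemma memLp_id_map {X : Ω → ℝ} (hX : MemLp X 2 P) : MemLp id 2 (P.map X) :=
  (memLp_map_measure_iff aestronglyMeasurable_id hX.aestronglyMeasurable.aemeasurable).2 hX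

/-- A random variable with characteristic function `exp (c ψ(θ))` has mean `c m` and variance
`c v`. -/
lemma mean_variance_of_charFun_eq [IsProbabilityMeasure P]
    {X : Ω → ℝ} (hX : MemLp X 2 P) {ν : Measure ℝ}
    (hν2 : Integrable (fun z : ℝ => z ^ 2) ν) {a b c : ℝ}
    (hφ : ∀ θ : ℝ, charFun (P.map X) θ = Complex.exp (c * levyExponent a b ν θ)) :
    ∫ ω, X ω ∂P = c * (a + ∫ z in {z : ℝ | 1 < |z|}, z ∂ν) ∧
    Var[X; P] = c * (b + ∫ z, z ^ 2 ∂ν) := by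
  have hXm := hX.aestronglyMeasurable.aemeasurable
  have : IsProbabilityMeasure (P.map X) := Measure.isProbabilityMeasure_map hXm
  obtain ⟨h1, h2⟩ := moments_of_charFun_eq (memLp_id_map hX) hν2 hφ
  rw [integral_map hXm (by fun_prop)] at h1 h2
  refine ⟨h1, ?_⟩
  rw [variance_eq_sub hX, h1]
  simp only [Pi.pow_apply]
  rw [h2]
  ring

/-- Splitting E and F along E ∩ F gives four covariances; three pair disjoint sets and vanish by
independence, and Var L(E ∩ F) remains. -/
lemma IsLevyBasis.hasOrthogonalIncrements [IsProbabilityMeasure P]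
    (hL : IsLevyBasis P 𝓑 L) (h𝓑 : IsBoundedClass c 𝓑)
    (hL2 : ∀ E ∈ 𝓑, MemLp (L E) 2 P) {a b : ℝ} {ν : Measure ℝ}
    (hCQ : HasCharQuadruplet P 𝓑 L a b ν c) (hν2 : Integrable (fun z : ℝ => z ^ 2) ν) :
    HasOrthogonalIncrements P 𝓑 L c (a + ∫ z in {z : ℝ | 1 < |z|}, z ∂ν) (b + ∫ z, z ^ 2 ∂ν) where
  memLp := hL2
  integral_eq E hE := by
    rw [(mean_variance_of_charFun_eq (hL2 E hE) hν2 (hCQ.charFun_eq E hE)).1, mul_comm]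
    rfl
  covariance_eq E hE F hF := by
    have hmE := h𝓑.measurableSet E hE
    have hmF := h𝓑.measurableSet F hF
    have hI : E ∩ F ∈ 𝓑 := h𝓑.subset_mem E hE _ (hmE.inter hmF) Set.inter_subset_left
    have h1 : E \ F ∈ 𝓑 := h𝓑.subset_mem E hE _ (hmE.diff hmF) Set.sdiff_subset
    have h2 : F \ E ∈ 𝓑 := h𝓑.subset_mem F hF _ (hmF.diff hmE) Set.sdiff_subset
    have d1 : Disjoint (E ∩ F) (E \ F) := by
      rw [Set.disjoint_left]; rintro x ⟨_, hx⟩ ⟨_, hx'⟩; exact hx' hx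
    have d2 : Disjoint (E ∩ F) (F \ E) := by
      rw [Set.disjoint_left]; rintro x ⟨hx, _⟩ ⟨_, hx'⟩; exact hx' hx
    have d3 : Disjoint (E \ F) (F \ E) := by
      rw [Set.disjoint_left]; rintro x ⟨hx, _⟩ ⟨_, hx'⟩; exact hx' hx
    have e1 := hL.union_ae_eq h𝓑 hI h1 d1
    have e2 := hL.union_ae_eq h𝓑 hI h2 d2
    rw [Set.inter_union_sdiff] at e1
    rw [Set.inter_comm E F, Set.inter_union_sdiff, Set.inter_comm F E] at e2
    rw [covariance_congr_ae e1 e2, covariance_add_left (hL2 _ hI) (hL2 _ h1)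
      ((hL2 _ hI).add (hL2 _ h2)), covariance_add_right (hL2 _ hI) (hL2 _ hI) (hL2 _ h2),
      covariance_add_right (hL2 _ h1) (hL2 _ hI) (hL2 _ h2),
      (hL.indepFun h𝓑 hI h2 d2).covariance_eq_zero (hL2 _ hI) (hL2 _ h2),
      (hL.indepFun h𝓑 h1 hI d1.symm).covariance_eq_zero (hL2 _ h1) (hL2 _ hI),
      (hL.indepFun h𝓑 h1 h2 d3).covariance_eq_zero (hL2 _ h1) (hL2 _ h2),
      covariance_self (hL2 _ hI).aestronglyMeasurable.aemeasurable,
      (mean_variance_of_charFun_eq (hL2 _ hI) hν2 (hCQ.charFun_eq _ hI)).2]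
    simp only [add_zero]
    rw [mul_comm]
    rfl

/-! ### Elementary stochastic integrals -/

/-- The pairs of an elementary integrand and its stochastic integral. -/
def elementaryPairs (𝓑 : Set (Set (Pt d))) (L : Set (Pt d) → Ω → ℝ) :
    Submodule ℝ ((Pt d → ℝ) × (Ω → ℝ)) :=
  Submodule.span ℝ {p | ∃ E ∈ 𝓑, p = (E.indicator (fun _ => 1), L E)}

/-- Restriction to a Borel set stays within the linear span, so simple integrands can later be cut
along a set and glued. -/
lemma SimpleFn.mem_elementaryPairs {Ω : Type*} {L : Set (Pt d) → Ω → ℝ}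
    (h𝓑 : IsBoundedClass c 𝓑) (g : SimpleFn 𝓑) {B : Set (Pt d)}
    (hB : MeasurableSet B) :
    (B.indicator g.toFun, g.integral L B) ∈ elementaryPairs 𝓑 L := by
  have hsum : (B.indicator g.toFun, g.integral L B)
      = ∑ j, g.y j • (((B ∩ g.E j).indicator (fun _ => (1 : ℝ)), L (B ∩ g.E j)) :
        (Pt d → ℝ) × (Ω → ℝ)) := by
    refine Prod.ext ?_ ?_
    · ext z
      simp only [Prod.fst_sum, Prod.smul_fst, Finset.sum_apply, Pi.smul_apply, smul_eq_mul]
      by_cases hz : z ∈ B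
      · rw [Set.indicator_of_mem hz, SimpleFn.toFun]
        refine Finset.sum_congr rfl fun j _ => ?_
        rw [← Set.indicator_indicator, Set.indicator_of_mem hz]
      · simp [hz]
    · ext ω
      simp only [Prod.snd_sum, Prod.smul_snd, Finset.sum_apply, Pi.smul_apply, smul_eq_mul]
      rfl
  rw [hsum]
  refine Submodule.sum_mem _ fun j _ => Submodule.smul_mem _ _ (Submodule.subset_span ⟨_, ?_, rfl⟩)
  exact h𝓑.subset_mem _ (g.mem j) _ (hB.inter (h𝓑.measurableSet _ (g.mem j)))
    Set.inter_subset_right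

lemma memLp_fst_of_mem_elementaryPairs {Ω : Type*} {L : Set (Pt d) → Ω → ℝ}
    (h𝓑 : IsBoundedClass c 𝓑) {p : (Pt d → ℝ) × (Ω → ℝ)} (hp : p ∈ elementaryPairs 𝓑 L) (q : ℝ≥0∞) : MemLp p.1 q c := by
  induction hp using Submodule.span_induction with
  | mem x hx =>
    obtain ⟨E, hE, rfl⟩ := hx
    exact memLp_indicator_const q (h𝓑.measurableSet E hE) 1 (Or.inr (h𝓑.measure_lt_top E hE).ne)
  | zero => exact MemLp.zero
  | add x y _ _ h1 h2 => exact h1.add h2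
  | smul r x _ h => exact h.const_smul r

variable {m v : ℝ}

lemma HasOrthogonalIncrements.memLp_snd (hO : HasOrthogonalIncrements P 𝓑 L c m v)
    {p : (Pt d → ℝ) × (Ω → ℝ)} (hp : p ∈ elementaryPairs 𝓑 L) : MemLp p.2 2 P := by
  induction hp using Submodule.span_induction with
  | mem x hx =>
    obtain ⟨E, hE, rfl⟩ := hx
    exact hO.memLp E hE
  | zero => exact MemLp.zero
  | add x y _ _ h1 h2 => exact h1.add h2
  | smul r x _ h => exact h.const_smul r

lemma HasOrthogonalIncrements.integral_snd [IsProbabilityMeasure P]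
    (hO : HasOrthogonalIncrements P 𝓑 L c m v)
    (h𝓑 : IsBoundedClass c 𝓑) {p : (Pt d → ℝ) × (Ω → ℝ)} (hp : p ∈ elementaryPairs 𝓑 L) :
    ∫ ω, p.2 ω ∂P = m * ∫ z, p.1 z ∂c := by
  induction hp using Submodule.span_induction with
  | mem x hx =>
    obtain ⟨E, hE, rfl⟩ := hx
    rw [hO.integral_eq E hE, integral_indicator (h𝓑.measurableSet E hE)]
    simp
  | zero => simp
  | add x y hx hy h1 h2 =>
    simp only [Prod.snd_add, Prod.fst_add, Pi.add_apply]
    rw [integral_add ((hO.memLp_snd hx).integrable (by norm_num))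
      ((hO.memLp_snd hy).integrable (by norm_num)),
      integral_add (memLp_one_iff_integrable.1 (memLp_fst_of_mem_elementaryPairs h𝓑 hx 1))
      (memLp_one_iff_integrable.1 (memLp_fst_of_mem_elementaryPairs h𝓑 hy 1)), h1, h2]
    ring
  | smul r x _ h =>
    simp only [Prod.smul_snd, Prod.smul_fst, Pi.smul_apply, smul_eq_mul]
    rw [integral_const_mul, integral_const_mul, h]
    ring

lemma HasOrthogonalIncrements.covariance_snd [IsProbabilityMeasure P]
    (hO : HasOrthogonalIncrements P 𝓑 L c m v)
    (h𝓑 : IsBoundedClass c 𝓑) {p q : (Pt d → ℝ) × (Ω → ℝ)} (hp : p ∈ elementaryPairs 𝓑 L)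
    (hq : q ∈ elementaryPairs 𝓑 L) : cov[p.2, q.2; P] = v * ∫ z, p.1 z * q.1 z ∂c := by
  have hint {p q : (Pt d → ℝ) × (Ω → ℝ)} (hp : p ∈ elementaryPairs 𝓑 L)
      (hq : q ∈ elementaryPairs 𝓑 L) : Integrable (fun z => p.1 z * q.1 z) c :=
    (memLp_fst_of_mem_elementaryPairs h𝓑 hp 2).integrable_mul
      (memLp_fst_of_mem_elementaryPairs h𝓑 hq 2)
  induction hp using Submodule.span_induction with
  | mem x hx =>
    obtain ⟨E, hE, rfl⟩ := hx
    have hE' : (E.indicator (fun _ => 1), L E) ∈ elementaryPairs 𝓑 L :=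
      Submodule.subset_span ⟨E, hE, rfl⟩
    induction hq using Submodule.span_induction with
    | mem y hy =>
      obtain ⟨F, hF, rfl⟩ := hy
      rw [hO.covariance_eq E hE F hF]
      simp_rw [← Set.inter_indicator_mul]
      rw [integral_indicator ((h𝓑.measurableSet E hE).inter (h𝓑.measurableSet F hF))]
      simp
    | zero => simp
    | add x y hx hy h1 h2 =>
      simp only [Prod.snd_add, Prod.fst_add, Pi.add_apply, mul_add] at *
      rw [covariance_add_right (hO.memLp E hE) (hO.memLp_snd hx) (hO.memLp_snd hy),
        integral_add (hint hE' hx) (hint hE' hy), h1, h2]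
      ring
    | smul r x _ h =>
      simp only [Prod.smul_snd, Prod.smul_fst, Pi.smul_apply, smul_eq_mul] at *
      rw [covariance_smul_right, h]
      simp_rw [mul_left_comm _ r]
      rw [integral_const_mul]
      ring
  | zero => simp
  | add x y hx hy h1 h2 =>
    simp only [Prod.snd_add, Prod.fst_add, Pi.add_apply, add_mul] at *
    rw [covariance_add_left (hO.memLp_snd hx) (hO.memLp_snd hy) (hO.memLp_snd hq),
      integral_add (hint hx hq) (hint hy hq), h1, h2]
    ring
  | smul r x _ h =>
    simp only [Prod.smul_snd, Prod.smul_fst, Pi.smul_apply, smul_eq_mul] at *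
    rw [covariance_smul_left, h]
    simp_rw [mul_assoc]
    rw [integral_const_mul]
    ring

/-- The `L²` norm of an elementary stochastic integral is controlled by the `L¹` and `L²` norms of
the integrand. -/
lemma HasOrthogonalIncrements.eLpNorm_snd_le [IsProbabilityMeasure P]
    (hO : HasOrthogonalIncrements P 𝓑 L c m v)
    (h𝓑 : IsBoundedClass c 𝓑) {p : (Pt d → ℝ) × (Ω → ℝ)} (hp : p ∈ elementaryPairs 𝓑 L) :
    eLpNorm p.2 2 P ≤ ENNReal.ofReal (|m| + √|v|) * sumNorm c p.1 := by
  have hp2 := hO.memLp_snd hp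
  have hm2 := memLp_fst_of_mem_elementaryPairs h𝓑 hp 2
  -- The integral is split into its centred part, governed by v and the L² norm, and its mean,
  -- governed by m and the L¹ norm. The absolute value |v| appears because no sign of v is assumed.
  have hvar : ∫ ω, (p.2 ω - ∫ ω, p.2 ω ∂P) ^ 2 ∂P = v * ∫ z, p.1 z ^ 2 ∂c := by
    have h := hO.covariance_snd h𝓑 hp hp
    unfold covariance at h
    simpa only [← sq] using h
  have h1 : eLpNorm (fun ω => p.2 ω - ∫ ω, p.2 ω ∂P) 2 P
      ≤ ENNReal.ofReal (√|v|) * eLpNorm p.1 2 c := by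
    rw [eLpNorm_two_eq_ofReal_sqrt (X := fun ω => p.2 ω - ∫ ω, p.2 ω ∂P)
      (hp2.sub (memLp_const _)), eLpNorm_two_eq_ofReal_sqrt hm2,
      ← ENNReal.ofReal_mul (by positivity), ← Real.sqrt_mul (abs_nonneg v)]
    refine ENNReal.ofReal_le_ofReal (Real.sqrt_le_sqrt ?_)
    rw [hvar]
    exact mul_le_mul_of_nonneg_right (le_abs_self v) (integral_nonneg fun z => sq_nonneg _)
  have h2 : eLpNorm (fun _ : Ω => ∫ ω, p.2 ω ∂P) 2 P ≤ ENNReal.ofReal |m| * eLpNorm p.1 1 c := by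
    rw [eLpNorm_const _ (by norm_num) (NeZero.ne P), hO.integral_snd h𝓑 hp, enorm_mul,
      measure_univ, ENNReal.one_rpow, mul_one, eLpNorm_one_eq_lintegral_enorm,
      Real.enorm_eq_ofReal_abs]
    gcongr
    exact enorm_integral_le_lintegral_enorm _
  calc eLpNorm p.2 2 P
      = eLpNorm ((fun ω => p.2 ω - ∫ ω, p.2 ω ∂P) + fun _ : Ω => ∫ ω, p.2 ω ∂P) 2 P := by
        congr 1; ext ω; simp
    _ ≤ ENNReal.ofReal (√|v|) * eLpNorm p.1 2 c + ENNReal.ofReal |m| * eLpNorm p.1 1 c :=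
        (eLpNorm_add_le (hp2.sub (memLp_const _)).aestronglyMeasurable (by fun_prop)
          (by norm_num)).trans (add_le_add h1 h2)
    _ ≤ ENNReal.ofReal (|m| + √|v|) * sumNorm c p.1 := by
        unfold sumNorm
        rw [mul_add, add_comm]
        gcongr
        · linarith [Real.sqrt_nonneg |v|]
        · linarith [abs_nonneg m]

/-- The difference of the pairs has integrand 0, so the norm bound annihilates its integral. This
replaces any common refinement of two representations of a simple function. -/
lemma HasOrthogonalIncrements.snd_ae_eq [IsProbabilityMeasure P]
    (hO : HasOrthogonalIncrements P 𝓑 L c m v)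
    (h𝓑 : IsBoundedClass c 𝓑) {p q : (Pt d → ℝ) × (Ω → ℝ)} (hp : p ∈ elementaryPairs 𝓑 L)
    (hq : q ∈ elementaryPairs 𝓑 L) (h : p.1 = q.1) : p.2 =ᵐ[P] q.2 := by
  have hle := hO.eLpNorm_snd_le h𝓑 (Submodule.sub_mem _ hp hq)
  have h0 : eLpNorm (p.2 - q.2) 2 P = 0 := by
    refine le_antisymm (hle.trans ?_) zero_le
    simp [h, sumNorm]
  rw [eLpNorm_eq_zero_iff ((hO.memLp_snd hp).sub (hO.memLp_snd hq)).aestronglyMeasurable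
    (by norm_num)] at h0
  filter_upwards [h0] with ω hω
  exact sub_eq_zero.1 hω

end MSTOU

namespace MSTOU

/-! ### Exhaustion, Egorov's theorem and the gliding hump -/

section General

variable {α : Type*} [MeasurableSpace α] {μ : Measure α}

lemma tendsto_eLpNorm_indicator_compl {C : ℕ → Set α} (hC : ∀ k, MeasurableSet (C k))
    (hmono : Monotone C) (hfull : ∀ᵐ x ∂μ, ∃ k, x ∈ C k) {q : ℝ≥0∞} (hq0 : q ≠ 0) (hq : q ≠ ∞)
    {φ : α → ℝ} (hφ : MemLp φ q μ) :
    Tendsto (fun k => eLpNorm ((C k)ᶜ.indicator φ) q μ) atTop (𝓝 0) := by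
  have hqr : 0 < q.toReal := ENNReal.toReal_pos hq0 hq
  simp_rw [eLpNorm_eq_lintegral_rpow_enorm_toReal hq0 hq]
  have key : Tendsto (fun k => ∫⁻ x, ‖(C k)ᶜ.indicator φ x‖ₑ ^ q.toReal ∂μ) atTop
      (𝓝 (∫⁻ _, 0 ∂μ)) := by
    refine tendsto_lintegral_of_dominated_convergence' (fun x => ‖φ x‖ₑ ^ q.toReal)
      (fun k => ((hφ.aestronglyMeasurable.indicator (hC k).compl).enorm.pow_const _))
      (fun k => Eventually.of_forall fun x => ?_)
      (lintegral_rpow_enorm_lt_top_of_eLpNorm_lt_top hq0 hq hφ.2).ne ?_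
    · exact ENNReal.rpow_le_rpow (enorm_indicator_le_enorm_self _ _) hqr.le
    · filter_upwards [hfull] with x hx
      obtain ⟨k₀, hk₀⟩ := hx
      refine tendsto_const_nhds.congr' ?_
      filter_upwards [eventually_ge_atTop k₀] with k hk
      have : x ∉ (C k)ᶜ := fun h => h (hmono hk hk₀)
      simp [this, hqr]
  have := key.ennrpow_const (1 / q.toReal)
  simpa [hqr] using this

lemma tendsto_sumNorm_indicator_compl {C : ℕ → Set α} (hC : ∀ k, MeasurableSet (C k))
    (hmono : Monotone C) (hfull : ∀ᵐ x ∂μ, ∃ k, x ∈ C k)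
    {φ : α → ℝ} (hφ1 : MemLp φ 1 μ) (hφ2 : MemLp φ 2 μ) :
    Tendsto (fun k => sumNorm μ ((C k)ᶜ.indicator φ)) atTop (𝓝 0) := by
  simpa [sumNorm] using (tendsto_eLpNorm_indicator_compl hC hmono hfull one_ne_zero ENNReal.one_ne_top
    hφ1).add (tendsto_eLpNorm_indicator_compl hC hmono hfull two_ne_zero ENNReal.ofNat_ne_top hφ2)

/-- A uniform error ε on C costs at most ε(μ(C) + μ(C)^{1/2}), which is finite and linear in ε. -/
lemma tendsto_sumNorm_indicator_of_tendstoUniformlyOn {C : Set α}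
    (hμC : μ C ≠ ∞) {φ : ℕ → α → ℝ} {g : α → ℝ} (h : TendstoUniformlyOn φ g atTop C) :
    Tendsto (fun n => sumNorm μ (C.indicator (φ n - g))) atTop (𝓝 0) := by
  set K : ℝ≥0∞ := μ C ^ (1 / (1 : ℝ≥0∞).toReal) + μ C ^ (1 / (2 : ℝ≥0∞).toReal) with hK
  have hKtop : K ≠ ∞ := by
    rw [hK]
    exact ENNReal.add_ne_top.2 ⟨ENNReal.rpow_ne_top_of_nonneg (by simp) hμC,
      ENNReal.rpow_ne_top_of_nonneg (by simp) hμC⟩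
  have hle (ε : ℝ) (hε : 0 < ε) : ∀ᶠ n in atTop,
      sumNorm μ (C.indicator (φ n - g)) ≤ ENNReal.ofReal ε * K := by
    filter_upwards [Metric.tendstoUniformlyOn_iff.1 h ε hε] with n hn
    have hpt (x : α) : ‖C.indicator (φ n - g) x‖ ≤ ‖C.indicator (fun _ => ε) x‖ := by
      by_cases hx : x ∈ C
      · simp only [Set.indicator_of_mem hx, Pi.sub_apply]
        have := hn x hx
        rw [dist_comm, Real.dist_eq] at this
        rw [Real.norm_eq_abs, Real.norm_of_nonneg hε.le]
        exact this.le
      · simp [hx]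
    refine (sumNorm_mono hpt).trans ?_
    rw [hK, mul_add, ← Real.enorm_of_nonneg hε.le]
    exact add_le_add (eLpNorm_indicator_const_le _ _) (eLpNorm_indicator_const_le _ _)
  rw [ENNReal.tendsto_nhds_zero]
  intro δ hδ
  have hlim : Tendsto (fun ε : ℝ => ENNReal.ofReal ε * K) (𝓝[>] 0) (𝓝 0) := by
    have h1 : Tendsto (fun ε : ℝ => ENNReal.ofReal ε) (𝓝[>] 0) (𝓝 0) := by
      simpa using (ENNReal.continuous_ofReal.tendsto 0).mono_left nhdsWithin_le_nhds
    simpa using ENNReal.Tendsto.mul_const h1 (Or.inr hKtop)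
  obtain ⟨ε, hε1, hε2⟩ :=
    ((ENNReal.tendsto_nhds_zero.1 hlim δ hδ).and self_mem_nhdsWithin).exists
  filter_upwards [hle ε hε2] with n hn
  exact hn.trans hε1

/-- Egorov's theorem on a space exhausted by sets of finite measure: the convergence is uniform on
each member of an increasing sequence of sets that covers almost everything. -/
lemma exists_monotone_tendstoUniformlyOn {K : ℕ → Set α} (hK : ∀ k, MeasurableSet (K k))
    (hKmono : Monotone K) (hKfull : ⋃ k, K k = Set.univ) (hKfin : ∀ k, μ (K k) ≠ ∞)
    {φ : ℕ → α → ℝ} {g : α → ℝ} (hφ : ∀ n, StronglyMeasurable (φ n)) (hg : StronglyMeasurable g)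
    (hlim : ∀ᵐ x ∂μ, Tendsto (fun n => φ n x) atTop (𝓝 (g x))) :
    ∃ C : ℕ → Set α, (∀ k, MeasurableSet (C k)) ∧ Monotone C ∧ (∀ k, C k ⊆ K k) ∧
      (∀ᵐ x ∂μ, ∃ k, x ∈ C k) ∧ ∀ k, TendstoUniformlyOn φ g atTop (C k) := by
  have hpos (k : ℕ) : (0 : ℝ) < 1 / ((k : ℝ) + 1) := Nat.one_div_pos_of_nat
  choose t htK htm htμ htu using fun k => tendstoUniformlyOn_of_ae_tendsto hφ hg (hK k) (hKfin k)
    (hlim.mono fun x hx _ => hx) (hpos k)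
  refine ⟨Set.accumulate fun k => K k \ t k, fun k => ?_, Set.monotone_accumulate, fun k => ?_, ?_,
    fun k => ?_⟩
  · exact MeasurableSet.biUnion (Set.to_countable _) fun i _ => (hK i).diff (htm i)
  · exact Set.iUnion₂_subset fun i hi => Set.sdiff_subset.trans (hKmono hi)
  · rw [ae_iff]
    -- A missed point lies in K k for every k ≥ i, hence in every exceptional set t k with k ≥ i.
    -- Since μ(t k) → 0, the intersection of these is null; no summability of the measures is
    -- needed.
    have hsub : {x | ¬∃ k, x ∈ Set.accumulate (fun k => K k \ t k) k} ⊆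
        ⋃ i, ⋂ j, t (i + j) := by
      intro x hx
      have hx' : ∀ k, x ∉ K k \ t k := fun k hk => hx ⟨k, Set.subset_accumulate hk⟩
      obtain ⟨i, hi⟩ := Set.mem_iUnion.1 (hKfull ▸ Set.mem_univ x : x ∈ ⋃ k, K k)
      refine Set.mem_iUnion.2 ⟨i, Set.mem_iInter.2 fun j => ?_⟩
      by_contra hxt
      exact hx' (i + j) ⟨hKmono (Nat.le_add_right i j) hi, hxt⟩
    refine measure_mono_null hsub (measure_iUnion_null fun i => ?_)
    have hlim0 : Tendsto (fun j : ℕ => ENNReal.ofReal (1 / (((i + j : ℕ) : ℝ) + 1))) atTop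
        (𝓝 0) := by
      have h1 := (tendsto_one_div_add_atTop_nhds_zero_nat (𝕜 := ℝ)).comp
        (tendsto_add_atTop_nat i)
      have h2 := (ENNReal.continuous_ofReal.tendsto 0).comp h1
      simpa [Function.comp_def, add_comm i] using h2
    refine le_antisymm (ge_of_tendsto' hlim0 fun j => ?_) zero_le
    exact (measure_mono (Set.iInter_subset _ j)).trans (htμ (i + j))
  · induction k with
    | zero => simpa using htu 0
    | succ k ih =>
      rw [Set.accumulate_succ]
      rw [tendstoUniformlyOn_iff_tendsto] at ih ⊢
      have h := tendstoUniformlyOn_iff_tendsto.1 (htu (k + 1))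
      rw [← sup_principal, Filter.prod_sup]
      exact ih.sup h

/-- If `h` is close to `g` on `C`, small off `C'`, and the set `D` avoids `C' \ C`, then `h` is
close to `g` on `D`. -/
lemma sumNorm_indicator_sub_le {C C' D : Set α} (hC : MeasurableSet C) (hC' : MeasurableSet C')
    (hD : D ∩ C' ⊆ C) {h g : α → ℝ} (hh : AEStronglyMeasurable h μ)
    (hg : AEStronglyMeasurable g μ) :
    sumNorm μ (D.indicator (h - g)) ≤ sumNorm μ (C.indicator (h - g))
      + sumNorm μ (C'ᶜ.indicator h) + sumNorm μ (Cᶜ.indicator g) := by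
  have m1 : AEStronglyMeasurable (fun x => ‖C.indicator (h - g) x‖) μ :=
    ((hh.sub hg).indicator hC).norm
  have m2 : AEStronglyMeasurable (fun x => ‖C'ᶜ.indicator h x‖) μ :=
    (hh.indicator hC'.compl).norm
  have m3 : AEStronglyMeasurable (fun x => ‖Cᶜ.indicator g x‖) μ :=
    (hg.indicator hC.compl).norm
  have hpt (x : α) : ‖D.indicator (h - g) x‖ ≤ ‖((fun x => ‖C.indicator (h - g) x‖)
      + (fun x => ‖C'ᶜ.indicator h x‖) + fun x => ‖Cᶜ.indicator g x‖) x‖ := by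
    simp only [Pi.add_apply]
    rw [Real.norm_of_nonneg (add_nonneg (add_nonneg (norm_nonneg _) (norm_nonneg _))
      (norm_nonneg _))]
    by_cases hxD : x ∈ D
    · rw [Set.indicator_of_mem hxD]
      by_cases hxC : x ∈ C
      · rw [Set.indicator_of_mem hxC]
        linarith [norm_nonneg (C'ᶜ.indicator h x), norm_nonneg (Cᶜ.indicator g x)]
      · have hxC' : x ∈ C'ᶜ := fun hx => hxC (hD ⟨hxD, hx⟩)
        have hxC2 : x ∈ Cᶜ := hxC
        rw [Set.indicator_of_mem hxC', Set.indicator_of_mem hxC2]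
        have := norm_sub_le (h x) (g x)
        simp only [Pi.sub_apply]
        linarith [norm_nonneg (C.indicator (h - g) x)]
    · rw [Set.indicator_of_notMem hxD, norm_zero]
      positivity
  have hn (φ : α → ℝ) : sumNorm μ (fun x => ‖φ x‖) = sumNorm μ φ := by
    simp only [sumNorm, eLpNorm_norm]
  refine (sumNorm_mono hpt).trans ((sumNorm_add_le (m1.add m2) m3).trans ?_)
  rw [hn]
  gcongr
  refine (sumNorm_add_le m1 m2).trans ?_
  rw [hn, hn]

/-- A gliding hump: a sequence `φ n` converging to `g` locally in the sense of `sumNorm` has a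
subsequence whose odd and even terms converge to `g` on a set `D` and on its complement. -/
lemma exists_gliding_hump {C : ℕ → Set α} (hC : ∀ k, MeasurableSet (C k)) (hmono : Monotone C)
    (hfull : ∀ᵐ x ∂μ, ∃ k, x ∈ C k) {φ : ℕ → α → ℝ} {g : α → ℝ}
    (hφ1 : ∀ n, MemLp (φ n) 1 μ) (hφ2 : ∀ n, MemLp (φ n) 2 μ) (hg1 : MemLp g 1 μ)
    (hg2 : MemLp g 2 μ)
    (hlim : ∀ k, Tendsto (fun n => sumNorm μ ((C k).indicator (φ n - g))) atTop (𝓝 0)) :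
    ∃ (D : Set α) (n n' : ℕ → ℕ), MeasurableSet D ∧ Tendsto n atTop atTop ∧
      Tendsto n' atTop atTop ∧
      Tendsto (fun j => sumNorm μ (D.indicator (φ (n j) - g))) atTop (𝓝 0) ∧
      Tendsto (fun j => sumNorm μ (Dᶜ.indicator (φ (n' j) - g))) atTop (𝓝 0) := by
  have hpos (j : ℕ) : (0 : ℝ≥0∞) < ENNReal.ofReal (1 / ((j : ℝ) + 1)) :=
    ENNReal.ofReal_pos.2 Nat.one_div_pos_of_nat
  have hε : Tendsto (fun j : ℕ => ENNReal.ofReal (1 / ((j : ℝ) + 1))) atTop (𝓝 0) := by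
    simpa [Function.comp_def] using (ENNReal.continuous_ofReal.tendsto 0).comp
      (tendsto_one_div_add_atTop_nhds_zero_nat (𝕜 := ℝ))
  set ε : ℕ → ℝ≥0∞ := fun j => ENNReal.ofReal (1 / ((j : ℝ) + 1))
  -- Two alternating choices: N k j ≥ j is an index at which φ is within ε j of g on C k; then κ n j
  -- k > k is a level beyond which φ n has seminorm at most ε j. The recursion for k interleaves
  -- them.
  choose N hNj hN using fun k j : ℕ => ((eventually_ge_atTop j).and
    (ENNReal.tendsto_nhds_zero.1 (hlim k) (ε j) (hpos j))).exists
  choose κ hκ hκε using fun n j k : ℕ => ((eventually_ge_atTop (k + 1)).and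
    (ENNReal.tendsto_nhds_zero.1 (tendsto_sumNorm_indicator_compl hC hmono hfull (hφ1 n) (hφ2 n))
      (ε j) (hpos j))).exists
  obtain ⟨k, hk⟩ : ∃ k : ℕ → ℕ, ∀ j, k (j + 1) = κ (N (k j) j) j (k j) :=
    ⟨fun j => Nat.rec 0 (fun j kj => κ (N kj j) j kj) j, fun _ => rfl⟩
  have hkmono : StrictMono k := strictMono_nat_of_lt_succ fun j => by
    rw [hk]; exact hκ _ _ _
  obtain ⟨n, hn⟩ : ∃ n : ℕ → ℕ, ∀ j, n j = N (k j) j := ⟨_, fun _ => rfl⟩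
  have hntop : Tendsto n atTop atTop :=
    tendsto_atTop_mono (fun j => (hNj (k j) j).trans (hn j).ge) tendsto_id
  have hCm : Monotone fun j => C (k j) := hmono.comp hkmono.monotone
  have hnear (j : ℕ) : sumNorm μ ((C (k j)).indicator (φ (n j) - g)) ≤ ε j := by
    rw [hn]; exact hN (k j) j
  have hoff (j : ℕ) : sumNorm μ ((C (k (j + 1)))ᶜ.indicator (φ (n j))) ≤ ε j := by
    rw [hk, hn]; exact hκε _ _ _
  have hgoff : Tendsto (fun j => sumNorm μ ((C (k j))ᶜ.indicator g)) atTop (𝓝 0) :=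
    (tendsto_sumNorm_indicator_compl hC hmono hfull hg1 hg2).comp hkmono.tendsto_atTop
  have hbound : Tendsto (fun j => ε j + ε j + sumNorm μ ((C (k j))ᶜ.indicator g)) atTop (𝓝 0) := by
    simpa using (hε.add hε).add hgoff
  -- φ (n j) is close to g on C (k j) and small off C (k (j + 1)); it is uncontrolled only on the
  -- shell in between, which D has to avoid.
  have hest (D : Set α) (j : ℕ) (hD : D ∩ C (k (j + 1)) ⊆ C (k j)) :
      sumNorm μ (D.indicator (φ (n j) - g)) ≤ ε j + ε j + sumNorm μ ((C (k j))ᶜ.indicator g) := by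
    refine (sumNorm_indicator_sub_le (hC _) (hC _) hD (hφ1 _).aestronglyMeasurable
      hg1.aestronglyMeasurable).trans ?_
    gcongr
    · exact hnear j
    · exact hoff j
  have hodd : Tendsto (fun j : ℕ => 2 * j + 1) atTop atTop :=
    tendsto_atTop_mono (fun j => by simp only [id]; omega) tendsto_id
  have heven : Tendsto (fun j : ℕ => 2 * j) atTop atTop :=
    tendsto_atTop_mono (fun j => by simp only [id]; omega) tendsto_id
  -- D collects the uncontrolled shells of the even indices. It therefore avoids those of the odd
  -- indices, and its complement avoids those of the even ones.
  refine ⟨⋃ j, C (k (2 * j + 1)) \ C (k (2 * j)), fun j => n (2 * j + 1), fun j => n (2 * j),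
    MeasurableSet.iUnion fun j => (hC _).diff (hC _), hntop.comp hodd, hntop.comp heven, ?_, ?_⟩
  · refine tendsto_of_tendsto_of_tendsto_of_le_of_le tendsto_const_nhds (hbound.comp hodd)
      (fun _ => zero_le) fun j => hest _ (2 * j + 1) ?_
    rintro x ⟨hx, hx'⟩
    obtain ⟨l, hl1, hl2⟩ := Set.mem_iUnion.1 hx
    have hlj : l ≤ j := by
      by_contra! hlt
      exact hl2 (hCm (by omega : 2 * j + 1 + 1 ≤ 2 * l) hx')
    exact hCm (by omega : 2 * l + 1 ≤ 2 * j + 1) hl1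
  · refine tendsto_of_tendsto_of_tendsto_of_le_of_le tendsto_const_nhds (hbound.comp heven)
      (fun _ => zero_le) fun j => hest _ (2 * j) ?_
    rintro x ⟨hx, hx'⟩
    by_contra hxC
    exact hx (Set.mem_iUnion.2 ⟨j, hx', hxC⟩)

end General

/-! ### Stochastic integrals as L² limits -/

variable {d : ℕ} {Ω : Type*} [MeasurableSpace Ω] {P : Measure Ω} [IsProbabilityMeasure P]
  {𝓑 : Set (Set (Pt d))} {L : Set (Pt d) → Ω → ℝ} {c : Measure (Pt d)} {m v : ℝ}

/-- The stochastic integral of an integrable and square integrable function is an `L²` limit of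
elementary integrals. -/
lemma HasOrthogonalIncrements.tendsto_of_tendstoInMeasure
    (hO : HasOrthogonalIncrements P 𝓑 L c m v) (h𝓑 : IsBoundedClass c 𝓑) {g : Pt d → ℝ}
    (hg : AEStronglyMeasurable g c) {Y : Ω → ℝ} {p : ℕ → (Pt d → ℝ) × (Ω → ℝ)}
    (hp : ∀ n, p n ∈ elementaryPairs 𝓑 L)
    (hpg : Tendsto (fun n => sumNorm c ((p n).1 - g)) atTop (𝓝 0))
    (hpY : TendstoInMeasure P (fun n => (p n).2) atTop Y) :
    MemLp Y 2 P ∧ Tendsto (fun n => eLpNorm ((p n).2 - Y) 2 P) atTop (𝓝 0) := by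
  set K : ℝ≥0∞ := ENNReal.ofReal (|m| + √|v|)
  have hms (n : ℕ) : AEStronglyMeasurable ((p n).1 - g) c :=
    (memLp_fst_of_mem_elementaryPairs h𝓑 (hp n) 1).aestronglyMeasurable.sub hg
  have hm2 (n : ℕ) := (hO.memLp_snd (hp n)).aestronglyMeasurable
  have hdiff (i j : ℕ) : eLpNorm ((p i).2 - (p j).2) 2 P
      ≤ K * (sumNorm c ((p i).1 - g) + sumNorm c ((p j).1 - g)) := by
    refine (hO.eLpNorm_snd_le h𝓑 (Submodule.sub_mem _ (hp i) (hp j))).trans ?_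
    gcongr
    have : (p i - p j).1 = ((p i).1 - g) - ((p j).1 - g) := by
      simp
    rw [this]
    exact sumNorm_sub_le (hms i) (hms j)
  have hconv : Tendsto (fun n => eLpNorm ((p n).2 - Y) 2 P) atTop (𝓝 0) := by
    rw [ENNReal.tendsto_nhds_zero]
    intro δ hδ
    have hlim : Tendsto (fun n : ℕ × ℕ => K * (sumNorm c ((p n.1).1 - g)
        + sumNorm c ((p n.2).1 - g))) (atTop ×ˢ atTop) (𝓝 0) := by
      have := ENNReal.Tendsto.const_mul (a := K) ((hpg.comp tendsto_fst).add
        (hpg.comp (tendsto_snd (f := (atTop : Filter ℕ))))) (Or.inr ENNReal.ofReal_ne_top)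
      simpa using this
    -- The Cauchy bound in (i, j) is used with i fixed and j → ∞: the L² norm is lower
    -- semicontinuous under convergence in probability, so p j may be replaced by its limit Y.
    filter_upwards [(ENNReal.tendsto_nhds_zero.1 hlim δ hδ).curry] with i hi
    refine eLpNorm_le_of_tendstoInMeasure (hi.mono fun j hj => (hdiff i j).trans hj)
      (tendstoInMeasure_const_sub _ hpY) fun j => (hm2 i).sub (hm2 j)
  refine ⟨?_, hconv⟩
  have hYm : AEStronglyMeasurable Y P := hpY.aestronglyMeasurable hm2
  obtain ⟨n, hn⟩ := (hconv.eventually_lt_const (ENNReal.zero_lt_top)).exists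
  have : MemLp ((p n).2 - Y) 2 P := ⟨(hm2 n).sub hYm, hn⟩
  simpa using (hO.memLp_snd (hp n)).sub this

lemma SimpleFn.stronglyMeasurable_toFun (h𝓑 : IsBoundedClass c 𝓑) (g : SimpleFn 𝓑) :
    StronglyMeasurable g.toFun := by
  refine Measurable.stronglyMeasurable ?_
  unfold SimpleFn.toFun
  exact Finset.measurable_fun_sum _ fun j _ => measurable_const.mul
    (measurable_const.indicator (h𝓑.measurableSet _ (g.mem j)))

/-- A stochastic integral is a limit in probability of elementary integrals whose integrands
converge in `L¹` and `L²`. -/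
lemma IsStochIntegral.exists_elementaryPairs (hO : HasOrthogonalIncrements P 𝓑 L c m v)
    (h𝓑 : IsBoundedClass c 𝓑) {g : Pt d → ℝ} {Y : Ω → ℝ}
    (hY : IsStochIntegral P 𝓑 L c g Set.univ Y) (hg1 : MemLp g 1 c) (hg2 : MemLp g 2 c) :
    ∃ p : ℕ → (Pt d → ℝ) × (Ω → ℝ), (∀ n, p n ∈ elementaryPairs 𝓑 L) ∧
      Tendsto (fun n => sumNorm c ((p n).1 - g)) atTop (𝓝 0) ∧
      TendstoInMeasure P (fun n => (p n).2) atTop Y := by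
  obtain ⟨hgm, gs, hlim, hB, hYlim⟩ := hY
  let x₀ : Pt d := (0, 0, ⟨1, Set.mem_Ioi.2 one_pos⟩)
  have hKmem (k : ℕ) : Metric.ball x₀ (k : ℝ) ∈ 𝓑 :=
    h𝓑.bounded_mem _ measurableSet_ball Metric.isBounded_ball
  obtain ⟨C, hC, hCmono, hCK, hCfull, hCu⟩ := exists_monotone_tendstoUniformlyOn (μ := c)
    (K := fun k : ℕ => Metric.ball x₀ (k : ℝ)) (fun k => measurableSet_ball)
    (fun i j hij => Metric.ball_subset_ball (by exact_mod_cast hij)) (Metric.iUnion_ball_nat x₀)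
    (fun k => (h𝓑.measure_lt_top _ (hKmem k)).ne)
    (fun n => (gs n).stronglyMeasurable_toFun h𝓑) hgm.stronglyMeasurable hlim
  have hmem (n : ℕ) {B : Set (Pt d)} (hB : MeasurableSet B) :
      (B.indicator (gs n).toFun, (gs n).integral L B) ∈ elementaryPairs 𝓑 L :=
    (gs n).mem_elementaryPairs h𝓑 hB
  have hgs (n : ℕ) (q : ℝ≥0∞) : MemLp (gs n).toFun q c := by
    simpa using memLp_fst_of_mem_elementaryPairs h𝓑 (hmem n MeasurableSet.univ) q
  obtain ⟨D, n, n', hD, hn, hn', hDg, hDg'⟩ := exists_gliding_hump hC hCmono hCfull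
    (fun n => hgs n 1) (fun n => hgs n 2) hg1 hg2 (fun k =>
      tendsto_sumNorm_indicator_of_tendstoUniformlyOn (ne_top_of_le_ne_top
        (h𝓑.measure_lt_top _ (hKmem k)).ne (measure_mono (hCK k))) (hCu k))
  obtain ⟨Z, hZ⟩ := hB D hD
  obtain ⟨Z', hZ'⟩ := hB Dᶜ hD.compl
  -- Along the full sequence the integrals over D and over its complement add up almost surely to
  -- the integral over the whole space, which identifies the sum of the limits.
  have hYZ : Z + Z' =ᵐ[P] Y := by
    refine tendstoInMeasure_ae_unique ?_ hYlim
    refine (tendstoInMeasure_add hZ hZ').congr_left fun k => ?_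
    refine hO.snd_ae_eq h𝓑 (Submodule.add_mem _ (hmem k hD) (hmem k hD.compl))
      (hmem k MeasurableSet.univ) ?_
    simp [Set.indicator_self_add_compl]
  -- Different subsequences may be used on the two pieces, since each piece converges in probability
  -- along the full sequence.
  refine ⟨fun j => (D.indicator (gs (n j)).toFun, (gs (n j)).integral L D)
    + (Dᶜ.indicator (gs (n' j)).toFun, (gs (n' j)).integral L Dᶜ),
    fun j => Submodule.add_mem _ (hmem _ hD) (hmem _ hD.compl), ?_, ?_⟩
  · have hsum := hDg.add hDg'
    rw [add_zero] at hsum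
    refine tendsto_of_tendsto_of_tendsto_of_le_of_le tendsto_const_nhds hsum
      (fun _ => zero_le) fun j => ?_
    have heq : D.indicator (gs (n j)).toFun + Dᶜ.indicator (gs (n' j)).toFun - g
        = D.indicator ((gs (n j)).toFun - g) + Dᶜ.indicator ((gs (n' j)).toFun - g) := by
      ext x
      by_cases hx : x ∈ D <;> simp [hx]
    simp only [Prod.fst_add]
    rw [heq]
    exact sumNorm_add_le
      (((hgs _ 1).sub hg1).aestronglyMeasurable.indicator hD)
      (((hgs _ 1).sub hg1).aestronglyMeasurable.indicator hD.compl)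
  · exact (tendstoInMeasure_add (hZ.comp hn) (hZ'.comp hn')).congr_right hYZ

/-- Second order properties of stochastic integrals. -/
lemma IsStochIntegral.memLp_and_integral_eq (hO : HasOrthogonalIncrements P 𝓑 L c m v)
    (h𝓑 : IsBoundedClass c 𝓑) {g : Pt d → ℝ} {Y : Ω → ℝ}
    (hY : IsStochIntegral P 𝓑 L c g Set.univ Y) (hg1 : MemLp g 1 c) (hg2 : MemLp g 2 c) :
    MemLp Y 2 P ∧ ∫ ω, Y ω ∂P = m * ∫ z, g z ∂c := by
  obtain ⟨p, hp, hpg, hpY⟩ := hY.exists_elementaryPairs hO h𝓑 hg1 hg2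
  obtain ⟨hY2, hlim⟩ := hO.tendsto_of_tendstoInMeasure h𝓑 hg1.aestronglyMeasurable hp hpg hpY
  refine ⟨hY2, tendsto_nhds_unique (tendsto_integral_of_tendsto_eLpNorm_two
    (fun n => hO.memLp_snd (hp n)) hY2 hlim) ?_⟩
  simp_rw [fun n => hO.integral_snd h𝓑 (hp n)]
  refine (tendsto_integral_of_L1' g hg1.aestronglyMeasurable (Eventually.of_forall fun n =>
    memLp_one_iff_integrable.1 (memLp_fst_of_mem_elementaryPairs h𝓑 (hp n) 1)) ?_).const_mul m
  exact tendsto_of_tendsto_of_tendsto_of_le_of_le tendsto_const_nhds hpg (fun _ => zero_le)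
    fun n => le_self_add

lemma IsStochIntegral.covariance_eq (hO : HasOrthogonalIncrements P 𝓑 L c m v)
    (h𝓑 : IsBoundedClass c 𝓑) {g g' : Pt d → ℝ} {Y Y' : Ω → ℝ}
    (hY : IsStochIntegral P 𝓑 L c g Set.univ Y) (hg1 : MemLp g 1 c) (hg2 : MemLp g 2 c)
    (hY' : IsStochIntegral P 𝓑 L c g' Set.univ Y') (hg1' : MemLp g' 1 c) (hg2' : MemLp g' 2 c) :
    cov[Y, Y'; P] = v * ∫ z, g z * g' z ∂c := by
  obtain ⟨p, hp, hpg, hpY⟩ := hY.exists_elementaryPairs hO h𝓑 hg1 hg2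
  obtain ⟨q, hq, hqg, hqY⟩ := hY'.exists_elementaryPairs hO h𝓑 hg1' hg2'
  obtain ⟨hY2, hlim⟩ := hO.tendsto_of_tendstoInMeasure h𝓑 hg1.aestronglyMeasurable hp hpg hpY
  obtain ⟨hY2', hlim'⟩ := hO.tendsto_of_tendstoInMeasure h𝓑 hg1'.aestronglyMeasurable hq hqg hqY
  refine tendsto_nhds_unique (tendsto_covariance_of_tendsto_eLpNorm (fun n => hO.memLp_snd (hp n))
    (fun n => hO.memLp_snd (hq n)) hY2 hY2' hlim hlim') ?_
  simp_rw [fun n => hO.covariance_snd h𝓑 (hp n) (hq n)]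
  refine (tendsto_integral_mul_of_tendsto_eLpNorm
    (fun n => memLp_fst_of_mem_elementaryPairs h𝓑 (hp n) 2)
    (fun n => memLp_fst_of_mem_elementaryPairs h𝓑 (hq n) 2) hg2 hg2' ?_ ?_).const_mul v
  · exact tendsto_of_tendsto_of_tendsto_of_le_of_le tendsto_const_nhds hpg (fun _ => zero_le)
      fun n => le_add_self
  · exact tendsto_of_tendsto_of_tendsto_of_le_of_le tendsto_const_nhds hqg (fun _ => zero_le)
      fun n => le_add_self

end MSTOU

namespace MSTOU

/-! ### Fubini for the control measure -/

variable {d : ℕ} {f : ℝ → ℝ}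

/-- The measure `f(λ) dλ` on `(0, ∞)`, as a measure on `ℝ`. -/
noncomputable def rateMeasure (f : ℝ → ℝ) : Measure ℝ :=
  (volume.restrict (Set.Ioi (0 : ℝ))).withDensity fun l => ENNReal.ofReal (f l)

instance sFinite_rateMeasure : SFinite (rateMeasure f) := by
  unfold rateMeasure; infer_instance

/-- The coordinates `((ξ, s), λ)` of a point `(ξ, s, λ)`. -/
def coords (z : Pt d) : (Space d × ℝ) × ℝ := ((z.1, z.2.1), z.2.2)

lemma measurable_coords : Measurable (coords (d := d)) := by
  unfold coords; fun_prop

lemma map_val_withDensity (hf : Measurable f) :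
    ((Measure.comap Subtype.val (volume : Measure ℝ) : Measure (Set.Ioi (0 : ℝ))).withDensity
      (fun l => ENNReal.ofReal (f l))).map Subtype.val = rateMeasure f := by
  ext s hs
  rw [Measure.map_apply measurable_subtype_coe hs, rateMeasure,
    withDensity_apply _ (measurable_subtype_coe hs), withDensity_apply _ hs,
    ← map_comap_subtype_coe measurableSet_Ioi, Measure.restrict_map measurable_subtype_coe hs,
    lintegral_map (by fun_prop) measurable_subtype_coe]

/-- Regrouping (ξ, (s, λ)) as ((ξ, s), λ), with λ regarded as a real number, makes the ambit set a
condition on the first factor alone and λ the outer variable of the iterated integrals. -/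
lemma map_coords_controlMeasure (hf : Measurable f) :
    (controlMeasure d f).map coords
      = (volume : Measure (Space d × ℝ)).prod (rateMeasure f) := by
  have : SigmaFinite (Measure.comap Subtype.val (volume : Measure ℝ) :
      Measure (Set.Ioi (0 : ℝ))) := by
    refine SigmaFinite.of_map _ measurable_subtype_coe.aemeasurable ?_
    rw [map_comap_subtype_coe measurableSet_Ioi]
    infer_instance
  set κ := ((Measure.comap Subtype.val (volume : Measure ℝ) :
    Measure (Set.Ioi (0 : ℝ))).withDensity (fun l => ENNReal.ofReal (f l))) with hκ
  have h1 : (controlMeasure d f).map (MeasurableEquiv.prodAssoc (α := Space d) (β := ℝ)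
      (γ := Set.Ioi (0 : ℝ))).symm = (volume : Measure (Space d × ℝ)).prod κ :=
    ((measurePreserving_prodAssoc (volume : Measure (Space d)) (volume : Measure ℝ) κ).symm _).map_eq
  have h2 : coords (d := d) = Prod.map id Subtype.val ∘ (MeasurableEquiv.prodAssoc (α := Space d)
      (β := ℝ) (γ := Set.Ioi (0 : ℝ))).symm := rfl
  rw [h2, ← Measure.map_map (by fun_prop) (by fun_prop), h1,
    ← Measure.map_prod_map _ _ measurable_id measurable_subtype_coe, Measure.map_id,
    map_val_withDensity hf]

lemma integrable_controlMeasure (hf : IsProbDensity f) {A : Set (Space d × ℝ)}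
    (hA : MeasurableSet A) {e : (Space d × ℝ) × ℝ → ℝ} (he : Measurable e) (he0 : ∀ p, 0 ≤ e p)
    (hfin : ∫⁻ l in Set.Ioi (0 : ℝ), ∫⁻ p in A, ENNReal.ofReal (e (p, l) * f l) < ∞) :
    Integrable (fun z : Pt d => A.indicator (fun p => e (p, z.2.2)) (z.1, z.2.1))
      (controlMeasure d f) := by
  set G : (Space d × ℝ) × ℝ → ℝ := (Prod.fst ⁻¹' A).indicator e with hG
  have hGm : Measurable G := he.indicator (measurable_fst hA)
  have hcomp : (fun z : Pt d => A.indicator (fun p => e (p, z.2.2)) (z.1, z.2.1))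
      = G ∘ coords := rfl
  rw [hcomp]
  refine Integrable.comp_measurable ?_ measurable_coords
  rw [map_coords_controlMeasure hf.measurable]
  have hG0 (p : (Space d × ℝ) × ℝ) : 0 ≤ G p := Set.indicator_nonneg (fun p _ => he0 p) p
  refine ⟨hGm.aestronglyMeasurable, ?_⟩
  rw [hasFiniteIntegral_iff_ofReal (Eventually.of_forall hG0),
    lintegral_prod_symm' _ hGm.ennreal_ofReal, rateMeasure,
    lintegral_withDensity_eq_lintegral_mul _ hf.measurable.ennreal_ofReal
      hGm.ennreal_ofReal.lintegral_prod_left']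
  refine (lintegral_congr fun l => ?_).trans_lt hfin
  rw [Pi.mul_apply, ← lintegral_const_mul (f := fun p => ENNReal.ofReal (G (p, l))) _
      (hGm.ennreal_ofReal.comp measurable_prodMk_right),
    ← lintegral_indicator hA]
  refine lintegral_congr fun p => ?_
  by_cases hp : p ∈ A
  · have : (p, l) ∈ (Prod.fst ⁻¹' A : Set ((Space d × ℝ) × ℝ)) := hp
    rw [hG, Set.indicator_of_mem this, Set.indicator_of_mem hp, ENNReal.ofReal_mul (he0 _),
      mul_comm]
  · have : (p, l) ∉ (Prod.fst ⁻¹' A : Set ((Space d × ℝ) × ℝ)) := hp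
    simp [hG, Set.indicator_of_notMem this, Set.indicator_of_notMem hp]

lemma integral_controlMeasure (hf : IsProbDensity f) {A : Set (Space d × ℝ)}
    (hA : MeasurableSet A) {e : (Space d × ℝ) × ℝ → ℝ} (he : Measurable e)
    (hint : Integrable (fun z : Pt d => A.indicator (fun p => e (p, z.2.2)) (z.1, z.2.1))
      (controlMeasure d f)) :
    ∫ z : Pt d, A.indicator (fun p => e (p, z.2.2)) (z.1, z.2.1) ∂(controlMeasure d f)
      = ∫ l in Set.Ioi (0 : ℝ), (∫ p in A, e (p, l)) * f l := by
  set G : (Space d × ℝ) × ℝ → ℝ := (Prod.fst ⁻¹' A).indicator e with hG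
  have hGm : Measurable G := he.indicator (measurable_fst hA)
  have hcomp : (fun z : Pt d => A.indicator (fun p => e (p, z.2.2)) (z.1, z.2.1))
      = G ∘ coords := rfl
  have hGint : Integrable G ((volume : Measure (Space d × ℝ)).prod (rateMeasure f)) := by
    rw [← map_coords_controlMeasure hf.measurable]
    exact (integrable_map_measure hGm.aestronglyMeasurable measurable_coords.aemeasurable).2
      (hcomp ▸ hint)
  have hGA (l : ℝ) : ∫ p, G (p, l) = ∫ p in A, e (p, l) := by
    rw [← integral_indicator hA]
    rfl
  calc ∫ z : Pt d, A.indicator (fun p => e (p, z.2.2)) (z.1, z.2.1) ∂(controlMeasure d f)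
      = ∫ z, G (coords z) ∂(controlMeasure d f) := by rw [hcomp]; rfl
    _ = ∫ y, G y ∂((volume : Measure (Space d × ℝ)).prod (rateMeasure f)) := by
        rw [← map_coords_controlMeasure hf.measurable,
          integral_map measurable_coords.aemeasurable hGm.aestronglyMeasurable]
    _ = ∫ l, (∫ p, G (p, l)) ∂(rateMeasure f) := integral_prod_symm _ hGint
    _ = ∫ l in Set.Ioi (0 : ℝ), (∫ p in A, e (p, l)) * f l := by
        rw [rateMeasure, integral_withDensity_eq_integral_toReal_smul
          (by have := hf.measurable; fun_prop) (Eventually.of_forall fun _ => ENNReal.ofReal_lt_top)]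
        refine setIntegral_congr_fun measurableSet_Ioi fun l hl => ?_
        simp only [hGA, smul_eq_mul]
        rw [ENNReal.toReal_ofReal (hf.nonneg l hl), mul_comm]

lemma controlMeasure_univ_ne_zero (hf : IsProbDensity f) :
    controlMeasure d f Set.univ ≠ 0 := by
  have h := map_coords_controlMeasure (d := d) hf.measurable
  have h1 : (controlMeasure d f).map coords Set.univ ≠ 0 := by
    rw [h, ← Set.univ_prod_univ, Measure.prod_prod]
    refine mul_ne_zero (NeZero.ne _) ?_
    rw [rateMeasure, withDensity_apply _ MeasurableSet.univ, Measure.restrict_univ,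
      hf.lintegral_eq_one]
    exact one_ne_zero
  rwa [Measure.map_apply measurable_coords MeasurableSet.univ, Set.preimage_univ] at h1

/-- Balls about a point exhaust S, whose measure is not 0. A set of positive measure is needed
because a null set carries no information about ν. -/
lemma IsBoundedClass.exists_pos_measure (hf : IsProbDensity f) {𝓑 : Set (Set (Pt d))}
    (h𝓑 : IsBoundedClass (controlMeasure d f) 𝓑) : ∃ E ∈ 𝓑, 0 < (controlMeasure d f E).toReal := by
  let x₀ : Pt d := (0, 0, ⟨1, Set.mem_Ioi.2 one_pos⟩)
  have hmem (k : ℕ) : Metric.ball x₀ (k : ℝ) ∈ 𝓑 :=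
    h𝓑.bounded_mem _ measurableSet_ball Metric.isBounded_ball
  by_contra! hcon
  refine controlMeasure_univ_ne_zero (d := d) hf ?_
  rw [← Metric.iUnion_ball_nat x₀]
  refine measure_iUnion_null fun k => ?_
  have h0 := le_antisymm (hcon _ (hmem k)) ENNReal.toReal_nonneg
  exact ((ENNReal.toReal_eq_zero_iff _).1 h0).resolve_right (h𝓑.measure_lt_top _ (hmem k)).ne

/-! ### The exponential kernel -/

section Kernel

variable {A : ℝ → Space d → Set (Space d × ℝ)}

lemma kernel_memLp_one (hf : IsProbDensity f) (hA : IsAmbit A) {t : ℝ} {x : Space d}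
    (hint : ∫⁻ l in Set.Ioi (0 : ℝ), ∫⁻ p in A t x,
      ENNReal.ofReal (Real.exp (-l * (t - p.2)) * f l) < ∞) :
    MemLp (kernel A t x) 1 (controlMeasure d f) :=
  memLp_one_iff_integrable.2 (integrable_controlMeasure hf (hA.measurableSet t x)
    (e := fun q => Real.exp (-q.2 * (t - q.1.2))) (by fun_prop) (fun _ => (Real.exp_pos _).le) hint)

/-- The exponents -λ(t - s) and -λ(t + dt - s) add up; the product of the indicators is that of the
intersection. -/
lemma kernel_mul_kernel (A : ℝ → Space d → Set (Space d × ℝ)) (t dt : ℝ) (x dx : Space d)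
    (z : Pt d) : kernel A t x z * kernel A (t + dt) (x + dx) z
      = (A t x ∩ A (t + dt) (x + dx)).indicator
        (fun p => Real.exp (-2 * (z.2.2 : ℝ) * (t - p.2) - z.2.2 * dt)) (z.1, z.2.1) := by
  unfold kernel
  rw [← Set.inter_indicator_mul]
  congr 1
  ext p
  rw [← Real.exp_add]
  congr 1
  ring

lemma kernel_memLp_two (hf : IsProbDensity f) (hA : IsAmbit A) {t : ℝ} {x : Space d}
    (hm : AEStronglyMeasurable (kernel A t x) (controlMeasure d f))
    (hint : ∫⁻ l in Set.Ioi (0 : ℝ), ∫⁻ p in A t x,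
      ENNReal.ofReal (Real.exp (-2 * l * (t - p.2)) * f l) < ∞) :
    MemLp (kernel A t x) 2 (controlMeasure d f) := by
  rw [memLp_two_iff_integrable_sq hm]
  refine (integrable_controlMeasure hf (hA.measurableSet t x)
    (e := fun q => Real.exp (-2 * q.2 * (t - q.1.2))) (by fun_prop)
    (fun _ => (Real.exp_pos _).le) hint).congr (Eventually.of_forall fun z => ?_)
  -- Zero lag turns the product into the square of the kernel.
  have h := kernel_mul_kernel A t 0 x 0 z
  simp only [add_zero, Set.inter_self, mul_zero, sub_zero, ← sq] at h
  exact h.symm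

end Kernel

end MSTOU

/-! ### Mean and covariance of the MSTOU process -/

theorem mainTheorem3 {d : ℕ} {Ω Ω' : Type*} [MeasurableSpace Ω] [MeasurableSpace Ω']
    (P : Measure Ω) [IsProbabilityMeasure P] (P' : Measure Ω') [IsProbabilityMeasure P']
    (f : ℝ → ℝ) (hf : MSTOU.IsProbDensity f)
    (𝓑 : Set (Set (MSTOU.Pt d)))
    (h𝓑 : MSTOU.IsBoundedClass (MSTOU.controlMeasure d f) 𝓑)
    (L : Set (MSTOU.Pt d) → Ω → ℝ) (hL : MSTOU.IsLevyBasis P 𝓑 L)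
    (a b : ℝ) (ν : Measure ℝ)
    (hCQ : MSTOU.HasCharQuadruplet P 𝓑 L a b ν (MSTOU.controlMeasure d f))
    -- finite second moments of the Lévy basis
    (hL2 : ∀ E ∈ 𝓑, MemLp (L E) 2 P)
    (A : ℝ → MSTOU.Space d → Set (MSTOU.Space d × ℝ)) (hA : MSTOU.IsAmbit A)
    -- integrability conditions on the kernel
    (hint₁ : ∀ t x, ∫⁻ l in Set.Ioi (0 : ℝ), ∫⁻ p in A t x,
      ENNReal.ofReal (Real.exp (-l * (t - p.2)) * f l) < ∞)
    (hint₂ : ∀ t x, ∫⁻ l in Set.Ioi (0 : ℝ), ∫⁻ p in A t x,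
      ENNReal.ofReal (Real.exp (-2 * l * (t - p.2)) * f l) < ∞)
    (Y : ℝ → MSTOU.Space d → Ω → ℝ)
    (hY : MSTOU.IsMSTOU P 𝓑 L (MSTOU.controlMeasure d f) A Y)
    (L' : Ω' → ℝ) (hL' : MSTOU.IsLevySeed P' L' a b ν) :
    -- the moments involved exist
    (∀ t x, MemLp (Y t x) 2 P) ∧ MemLp L' 2 P' ∧
    IntegrableOn (fun z : ℝ => z) {z | 1 < |z|} ν ∧ Integrable (fun z : ℝ => z ^ 2) ν ∧
    -- mean
    (∀ t x,
      ∫ ω, Y t x ω ∂P = (a + ∫ z in {z : ℝ | 1 < |z|}, z ∂ν) *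
          ∫ l in Set.Ioi (0 : ℝ), (∫ p in A t x, Real.exp (-l * (t - p.2))) * f l ∧
      ∫ ω, Y t x ω ∂P = (∫ ω, L' ω ∂P') *
          ∫ l in Set.Ioi (0 : ℝ), (∫ p in A t x, Real.exp (-l * (t - p.2))) * f l) ∧
    -- spatio-temporal covariance
    (∀ (t : ℝ) (x : MSTOU.Space d) (dt : ℝ) (dx : MSTOU.Space d),
      cov[Y t x, Y (t + dt) (x + dx); P] = (b + ∫ z, z ^ 2 ∂ν) *
          ∫ l in Set.Ioi (0 : ℝ), (∫ p in A t x ∩ A (t + dt) (x + dx),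
            Real.exp (-2 * l * (t - p.2) - l * dt)) * f l ∧
      cov[Y t x, Y (t + dt) (x + dx); P] = Var[L'; P'] *
          ∫ l in Set.Ioi (0 : ℝ), (∫ p in A t x ∩ A (t + dt) (x + dx),
            Real.exp (-2 * l * (t - p.2) - l * dt)) * f l) := by

  obtain ⟨E, hE, hcE⟩ := h𝓑.exists_pos_measure hf
  have hν2 : Integrable (fun z : ℝ => z ^ 2) ν := by
    have : IsProbabilityMeasure (P.map (L E)) :=
      Measure.isProbabilityMeasure_map (hL.measurable E hE).aemeasurable
    exact MSTOU.integrable_sq_levyMeasure (MSTOU.memLp_id_map (hL2 E hE)).integrable_sq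
      hCQ.b_nonneg hCQ.levyMeasure hcE (hCQ.charFun_eq E hE)
  have hL'2 : MemLp L' 2 P' := by
    have hm := hL'.measurable.aemeasurable (μ := P')
    have : IsProbabilityMeasure (P'.map L') := Measure.isProbabilityMeasure_map hm
    rw [memLp_two_iff_integrable_sq hm.aestronglyMeasurable]
    exact (MSTOU.integrable_sq_of_charFun_eq hν2 hL'.charFun_eq).comp_aemeasurable hm
  obtain ⟨hmean, hvar⟩ := MSTOU.mean_variance_of_charFun_eq (c := 1) hL'2 hν2
    (fun θ => by simpa using hL'.charFun_eq θ)
  rw [one_mul] at hmean hvar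
  have hO := hL.hasOrthogonalIncrements h𝓑 hL2 hCQ hν2
  have hk1 (t : ℝ) (x : MSTOU.Space d) := MSTOU.kernel_memLp_one hf hA (hint₁ t x)
  have hk2 (t : ℝ) (x : MSTOU.Space d) :=
    MSTOU.kernel_memLp_two hf hA (hk1 t x).aestronglyMeasurable (hint₂ t x)
  have hYm (t : ℝ) (x : MSTOU.Space d) :=
    (hY t x).memLp_and_integral_eq hO h𝓑 (hk1 t x) (hk2 t x)
  refine ⟨fun t x => (hYm t x).1, hL'2, MSTOU.integrableOn_id_of_integrable_sq hν2, hν2,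
    fun t x => ?_, fun t x dt dx => ?_⟩
  · rw [hmean, and_self, (hYm t x).2]
    congr 1
    exact MSTOU.integral_controlMeasure hf (hA.measurableSet t x)
      (e := fun q => Real.exp (-q.2 * (t - q.1.2))) (by fun_prop)
      (memLp_one_iff_integrable.1 (hk1 t x))
  · rw [hvar, and_self, (hY t x).covariance_eq hO h𝓑 (hk1 t x) (hk2 t x) (hY (t + dt) (x + dx))
      (hk1 _ _) (hk2 _ _)]
    congr 1
    have hi := (hk2 t x).integrable_mul (hk2 (t + dt) (x + dx))
    simp only [Pi.mul_def, MSTOU.kernel_mul_kernel] at hi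
    simp only [MSTOU.kernel_mul_kernel]
    exact MSTOU.integral_controlMeasure hf
      ((hA.measurableSet t x).inter (hA.measurableSet (t + dt) (x + dx)))
      (e := fun q => Real.exp (-2 * q.2 * (t - q.1.2) - q.2 * dt)) (by fun_prop) hi
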